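/- Let $G$ be a locally compact second countable Hausdorff group. All Hilbert spaces are complex and separable and carry a unitary representation $U$ of $G$ for which the action $g.A := U(g)AU(g)^*$ on $B(\mathcal H)$ is ultraweakly continuous. A *semi-quantum system* is an ultraweakly closed $G$-stable subspace $V\subseteq B(\mathcal H)$ with $\mathbb 1\in V$; a *channel* is an ultraweakly continuous (normal), positive, unital linear map $V\to V'$. The predual of $V$ is $\mathcal T(\mathcal H)/\!\sim_V$, where $T\sim_V T'$ iff $\mathrm{tr}[TA]=\mathrm{tr}[T'A]$ for all $A\in V$; a channel $\phi:V\to V'$ has the predual map $\phi_*$ given by $\mathrm{tr}[\phi_*(t)A]=\mathrm{tr}[t\,\phi(A)]$. A *principal semi-quantum frame* $\mathcal R$ is a semi-quantum system $V_{\mathcal R}\subseteq B(\mathcal H_{\mathcal R})$ with a positive operator-valued measure $\mathsf E_{\mathcal R}$ on the Borel sets of $G$ with values in $V_{\mathcal R}$ and $\mathsf E_{\mathcal R}(gX)=g.\mathsf E_{\mathcal R}(X)$; a *frame morphism* $\psi:\mathcal R\to\mathcal R'$ is a channel $\psi:V_{\mathcal R}\to V_{\mathcal R'}$ with $\mathsf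 E_{\mathcal R'}=\psi\circ\mathsf E_{\mathcal R}$. For a semi-quantum system $V_{\mathcal S}\subseteq B(\mathcal H_{\mathcal S})$ let $Y^{\mathcal R}(A)=\int_G d\mathsf E_{\mathcal R}(g)\otimes g.A\in B(\mathcal H_{\mathcal R}\otimes\mathcal H_{\mathcal S})$ (weak integral), let $V_{\mathcal S}^{\mathcal R}$ be the ultraweak closure of $Y^{\mathcal R}(V_{\mathcal S})$, and for states $\omega$ of $\mathcal H_{\mathcal R}$ (or trace-class $\omega$) and $\rho$ of $\mathcal H_{\mathcal S}$ let $\rho^{(\omega)}$ be the class of $\omega\otimes\rho$ in $\mathcal T(\mathcal H_{\mathcal R}\otimes\mathcal H_{\mathcal S})/\!\sim_{V_{\mathcal S}^{\mathcal R}}$ (equivalently, the functional $A\mapsto\mathrm{tr}[(\omega\otimes\rho)Y^{\mathcal R}(A)]$ on $V_{\mathcal S}$). Let $\psi:\mathcal R\to\mathcal R'$ be a frame morphism and fix a semi-quantum system $V_{\mathcal S}$. 1. The linear map $Y(\psi,\mathrm{id}_{\mathcal S}):Y^{\mathcal R}(A)\mapsto Y^{\mathcal R'}(A)$, $A\in V_{\mathcal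 S}$, is well defined on the ultraweakly dense subspace $Y^{\mathcal R}(V_{\mathcal S})$ of $V_{\mathcal S}^{\mathcal R}$. Let $\Phi^{\rm ext}_\psi=Y(\psi,\mathrm{id}_{\mathcal S})_*$ be its predual: its domain consists of those $t'\in\mathcal T(\mathcal H_{\mathcal R'}\otimes\mathcal H_{\mathcal S})/\!\sim_{V_{\mathcal S}^{\mathcal R'}}$ for which there is a (necessarily unique) $t\in\mathcal T(\mathcal H_{\mathcal R}\otimes\mathcal H_{\mathcal S})/\!\sim_{V_{\mathcal S}^{\mathcal R}}$ with $\mathrm{tr}[t\,B]=\mathrm{tr}[t'\,Y(\psi,\mathrm{id}_{\mathcal S})(B)]$ for all $B\in Y^{\mathcal R}(V_{\mathcal S})$, and then $\Phi^{\rm ext}_\psi(t')=t$. 2. For all states $\omega'$ of $\mathcal H_{\mathcal R'}$ and $\rho$ of $\mathcal H_{\mathcal S}$, the product-relative state $\rho^{(\omega')}$ lies in the domain of $\Phi^{\rm ext}_\psi$, and $$\Phi^{\rm ext}_\psi\big(\rho^{(\omega')}\big)=\rho^{(\psi_*(\omega'))},$$ where on the right any trace-class representative $\omega$ of $\psi_*(\omega')\in\mathcal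 T(\mathcal H_{\mathcal R})/\!\sim_{V_{\mathcal R}}$ may be used (if $V_{\mathcal R}=B(\mathcal H_{\mathcal R})$, it is a state). If $Y(\psi,\mathrm{id}_{\mathcal S})$ has an extension to an ultraweakly continuous linear map $V_{\mathcal S}^{\mathcal R}\to V_{\mathcal S}^{\mathcal R'}$, the everywhere defined predual of the extension also maps $\rho^{(\omega')}$ to $\rho^{(\psi_*(\omega'))}$. Moreover $\mathrm{tr}[(\omega'\otimes\rho)\,Y^{\mathcal R'}(A)]=\mathrm{tr}[(\omega\otimes\rho)\,Y^{\mathcal R}(A)]$ for all $A\in V_{\mathcal S}$. 3. For $h\in G$ let $h.\mathcal R$ be the reoriented frame, with $V_{h.\mathcal R}=V_{\mathcal R}$, observable $X\mapsto h.\mathsf E_{\mathcal R}(X)$ and representation $g\mapsto U(h)U(g)U(h)^*$. The frame reorientation $h.\_:V_{\mathcal R}\to V_{\mathcal R}$ is a frame morphism $\mathcal R\to h.\mathcal R$, and for all states $\omega$ of $\mathcal H_{\mathcal R}$ and $\rho$ of $\mathcal H_{\mathcal S}$ the map $\Phi^{\rm ext}_{h.\_}$ sends $\rho^{(\omega)}$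 (relative to $h.\mathcal R$) to $\rho^{(U(h)^*\omega U(h))}$ (relative to $\mathcal R$), where $U(h)^*\omega U(h)$ is a state. If $h.\_$ is also a frame morphism $\mathcal R\to\mathcal R$, then likewise $\Phi^{\rm ext}_{h.\_}$ sends $\rho^{(\omega)}$ to $\rho^{(U(h)^*\omega U(h))}$, both relative to $\mathcal R$. -/

import Mathlib

open scoped InnerProductSpace Topology
open InnerProductSpace MeasureTheory

namespace QRF

section TraceClass

variable {H : Type*} [NormedAddCommGroup H] [InnerProductSpace ℂ H] [CompleteSpace H]

/-- Trace-class operators on a Hilbert space (equivalently: nuclear operators, those with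
`∑ ⟪eᵢ, |T| eᵢ⟫ < ∞`): norm-convergent sums `∑ₙ |xₙ⟩⟨yₙ|` with `∑ₙ ‖xₙ‖ ‖yₙ‖ < ∞`. -/
def IsTraceClass (T : H →L[ℂ] H) : Prop :=
  ∃ x y : ℕ → H, Summable (fun n => ‖x n‖ * ‖y n‖) ∧
    HasSum (fun n => rankOne ℂ (x n) (y n)) T

variable (H) in
/-- The index set of a chosen orthonormal (Hilbert) basis. -/
def basisIndex : Set H := Classical.choose (exists_hilbertBasis ℂ H)

variable (H) in
/-- A chosen orthonormal (Hilbert) basis; the trace does not depend on it. -/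
noncomputable def basis : HilbertBasis (basisIndex H) ℂ H :=
  Classical.choose (Classical.choose_spec (exists_hilbertBasis ℂ H))

/-- The trace `∑ᵢ ⟪eᵢ, T eᵢ⟫`. -/
noncomputable def opTrace (T : H →L[ℂ] H) : ℂ :=
  ∑' i, ⟪basis H i, T (basis H i)⟫_ℂ

theorem hasSum_opTrace {T : H →L[ℂ] H} {x y : ℕ → H}
    (hs : Summable (fun n => ‖x n‖ * ‖y n‖)) (hT : HasSum (fun n => rankOne ℂ (x n) (y n)) T) :
    HasSum (fun i => ⟪basis H i, T (basis H i)⟫_ℂ) (opTrace T) ∧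
      HasSum (fun n => ⟪y n, x n⟫_ℂ) (opTrace T) := by
  set b := basis H with hb
  let F : ℕ × basisIndex H → ℂ := fun p => ⟪y p.1, b p.2⟫_ℂ * ⟪b p.2, x p.1⟫_ℂ
  have h1 : ∀ n, HasSum (fun i => F (n, i)) ⟪y n, x n⟫_ℂ := fun n =>
    b.hasSum_inner_mul_inner (y n) (x n)
  have h2 : ∀ n, Summable (fun i => ‖F (n, i)‖) := fun n => (h1 n).summable.norm
  have sq : ∀ z : H, HasSum (fun i => ‖⟪b i, z⟫_ℂ‖ ^ 2) (‖z‖ ^ 2) := by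
    intro z
    have := b.hasSum_inner_mul_inner z z
    have h := Complex.hasSum_re this
    convert h using 1
    · funext i
      rw [← inner_conj_symm z (b i), ← Complex.normSq_eq_conj_mul_self, Complex.ofReal_re,
        Complex.normSq_eq_norm_sq]
    · rw [inner_self_eq_norm_sq_to_K]; norm_cast
  have h3 : ∀ n, ∑' i, ‖F (n, i)‖ ≤ ‖x n‖ * ‖y n‖ := by
    intro n
    have hh := Real.inner_le_Lp_mul_Lq_tsum_of_nonneg (p := 2) (q := 2)
      (f := fun i => ‖⟪b i, y n⟫_ℂ‖)
      (g := fun i => ‖⟪b i, x n⟫_ℂ‖)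
      (by constructor <;> norm_num) (fun _ => norm_nonneg _) (fun _ => norm_nonneg _)
      (by simpa using (sq (y n)).summable) (by simpa using (sq (x n)).summable)
    have hx := (sq (x n)).tsum_eq
    have hy := (sq (y n)).tsum_eq
    have e : ∀ i, ‖F (n, i)‖ = ‖⟪b i, y n⟫_ℂ‖ * ‖⟪b i, x n⟫_ℂ‖ := by
      intro i; simp only [F, norm_mul]; rw [norm_inner_symm]
    simp only [e]
    refine hh.trans (le_of_eq ?_)
    simp only [Real.rpow_ofNat, hx, hy]
    rw [← Real.sqrt_eq_rpow, ← Real.sqrt_eq_rpow, Real.sqrt_sq (norm_nonneg _),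
      Real.sqrt_sq (norm_nonneg _), mul_comm]
  have hF : Summable F := by
    refine Summable.of_norm ?_
    refine (summable_prod_of_nonneg (fun _ => norm_nonneg _)).2 ⟨h2, ?_⟩
    exact Summable.of_nonneg_of_le (fun n => tsum_nonneg fun _ => norm_nonneg _) h3 hs
  have hA : HasSum (fun n => ⟪y n, x n⟫_ℂ) (∑' p, F p) := hF.hasSum.prod_fiberwise h1
  have h4 : ∀ i, HasSum (fun n => F (n, i)) ⟪b i, T (b i)⟫_ℂ := by
    intro i
    have := hT.mapL ((innerSL ℂ (b i)).comp (ContinuousLinearMap.apply ℂ H (b i)))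
    simpa [F, inner_smul_right] using this
  have hB : HasSum (fun i => ⟪b i, T (b i)⟫_ℂ) (∑' p, F p) := by
    have := ((Equiv.prodComm _ _).hasSum_iff.2 hF.hasSum : HasSum (F ∘ (Equiv.prodComm (basisIndex H) ℕ)) _)
    exact this.prod_fiberwise h4
  have e : opTrace T = ∑' p, F p := hB.tsum_eq
  rw [e]
  exact ⟨hB, hA⟩

theorem IsTraceClass.zero : IsTraceClass (0 : H →L[ℂ] H) :=
  ⟨0, 0, by simp, by simp⟩

theorem IsTraceClass.add {S T : H →L[ℂ] H} (hS : IsTraceClass S) (hT : IsTraceClass T) :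
    IsTraceClass (S + T) := by
  obtain ⟨x, y, h, h'⟩ := hS
  obtain ⟨u, v, k, k'⟩ := hT
  have e := Equiv.natSumNatEquivNat
  refine ⟨fun n => Sum.elim x u (e.symm n), fun n => Sum.elim y v (e.symm n), ?_, ?_⟩
  · refine (e.symm.summable_iff (f := fun s => ‖Sum.elim x u s‖ * ‖Sum.elim y v s‖)).2 ?_
    exact Summable.sum _ (by simpa [Function.comp_def] using h) (by simpa [Function.comp_def] using k)
  · refine (e.symm.hasSum_iff (f := fun s => rankOne ℂ (Sum.elim x u s) (Sum.elim y v s))).2 ?_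
    exact HasSum.sum (by simpa [Function.comp_def] using h') (by simpa [Function.comp_def] using k')

theorem IsTraceClass.comp_left {T : H →L[ℂ] H} (hT : IsTraceClass T) (A : H →L[ℂ] H) :
    IsTraceClass (A * T) := by
  obtain ⟨x, y, h, h'⟩ := hT
  refine ⟨fun n => A (x n), y, ?_, ?_⟩
  · refine Summable.of_nonneg_of_le (fun n => by positivity) (fun n => ?_) (h.mul_left ‖A‖)
    rw [← mul_assoc]; gcongr; exact A.le_opNorm _
  · have := h'.mul_left A
    simpa [ContinuousLinearMap.mul_def, comp_rankOne] using this

theorem IsTraceClass.comp_right {T : H →L[ℂ] H} (hT : IsTraceClass T) (A : H →L[ℂ] H) :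
    IsTraceClass (T * A) := by
  obtain ⟨x, y, h, h'⟩ := hT
  refine ⟨x, fun n => A.adjoint (y n), ?_, ?_⟩
  · refine Summable.of_nonneg_of_le (fun n => by positivity) (fun n => ?_) (h.mul_left ‖A.adjoint‖)
    rw [mul_left_comm]; gcongr; exact A.adjoint.le_opNorm _
  · have := h'.mul_right A
    simpa [ContinuousLinearMap.mul_def, rankOne_comp] using this

theorem IsTraceClass.smul {T : H →L[ℂ] H} (hT : IsTraceClass T) (c : ℂ) : IsTraceClass (c • T) := by
  have := hT.comp_left (c • 1)
  simpa using this

theorem IsTraceClass.hasSum_opTrace {T : H →L[ℂ] H} (hT : IsTraceClass T) :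
    HasSum (fun i => ⟪basis H i, T (basis H i)⟫_ℂ) (opTrace T) := by
  obtain ⟨x, y, h, h'⟩ := hT
  exact (QRF.hasSum_opTrace h h').1

theorem opTrace_mul_comm {T : H →L[ℂ] H} (hT : IsTraceClass T) (A : H →L[ℂ] H) :
    opTrace (A * T) = opTrace (T * A) := by
  obtain ⟨x, y, h, h'⟩ := hT
  have h1 : HasSum (fun n => ⟪y n, A (x n)⟫_ℂ) (opTrace (A * T)) := by
    refine (QRF.hasSum_opTrace ?_ ?_).2
    · refine Summable.of_nonneg_of_le (fun n => by positivity) (fun n => ?_) (h.mul_left ‖A‖)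
      rw [← mul_assoc]; gcongr; exact A.le_opNorm _
    · have := h'.mul_left A
      simpa [ContinuousLinearMap.mul_def, comp_rankOne] using this
  have h2 : HasSum (fun n => ⟪A.adjoint (y n), x n⟫_ℂ) (opTrace (T * A)) := by
    refine (QRF.hasSum_opTrace ?_ ?_).2
    · refine Summable.of_nonneg_of_le (fun n => by positivity) (fun n => ?_) (h.mul_left ‖A.adjoint‖)
      rw [mul_left_comm]; gcongr; exact A.adjoint.le_opNorm _
    · have := h'.mul_right A
      simpa [ContinuousLinearMap.mul_def, rankOne_comp] using this
  simp only [ContinuousLinearMap.adjoint_inner_left] at h2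
  exact h1.unique h2

variable (H) in
/-- The space `𝒯(H)` of trace-class operators. -/
def TraceClass : Submodule ℂ (H →L[ℂ] H) where
  carrier := {T | IsTraceClass T}
  zero_mem' := IsTraceClass.zero
  add_mem' := IsTraceClass.add
  smul_mem' c _ h := IsTraceClass.smul h c

variable (H) in
/-- The duality pairing `(T, A) ↦ tr[T A]` between trace-class and bounded operators. -/
noncomputable def tracePairing : TraceClass H →ₗ[ℂ] (H →L[ℂ] H) →ₗ[ℂ] ℂ :=
  LinearMap.mk₂ ℂ (fun T A => opTrace (T.1 * A))
    (fun S T A => by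
      have hS := (IsTraceClass.comp_right S.2 A).hasSum_opTrace
      have hT := (IsTraceClass.comp_right T.2 A).hasSum_opTrace
      have := (hS.add hT).tsum_eq
      rw [← this]
      simp [opTrace])
    (fun c T A => by
      simp [opTrace, tsum_mul_left])
    (fun T A B => by
      have hS := (IsTraceClass.comp_right T.2 A).hasSum_opTrace
      have hT := (IsTraceClass.comp_right T.2 B).hasSum_opTrace
      have := (hS.add hT).tsum_eq
      rw [← this]
      simp [opTrace])
    (fun c T A => by
      simp [opTrace, tsum_mul_left])

/-- (Quantum) states: positive trace-class operators of trace one. -/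
def IsState (ω : TraceClass H) : Prop :=
  (ω : H →L[ℂ] H).IsPositive ∧ opTrace (ω : H →L[ℂ] H) = 1

variable (H) in
/-- The ultraweak topology on `B(H)`: the coarsest one making all `A ↦ tr[T A]`, with `T`
trace class, continuous. -/
@[reducible]
noncomputable def ultraweak : TopologicalSpace (H →L[ℂ] H) :=
  ⨅ T : TraceClass H, TopologicalSpace.induced (tracePairing H T) inferInstance

end TraceClass

section Predual

variable {H : Type*} [NormedAddCommGroup H] [InnerProductSpace ℂ H] [CompleteSpace H]
variable {H' : Type*} [NormedAddCommGroup H'] [InnerProductSpace ℂ H'] [CompleteSpace H']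

/-- The ultraweak closure of a linear subspace of `B(H)`. -/
noncomputable def ultraweakClosure (V : Submodule ℂ (H →L[ℂ] H)) : Submodule ℂ (H →L[ℂ] H) :=
  letI : TopologicalSpace (H →L[ℂ] H) := ultraweak H
  haveI : IsTopologicalAddGroup (H →L[ℂ] H) :=
    topologicalAddGroup_iInf fun _ => topologicalAddGroup_induced _
  haveI : ContinuousSMul ℂ (H →L[ℂ] H) :=
    continuousSMul_iInf fun _ => continuousSMul_induced _
  V.topologicalClosure

theorem coe_ultraweakClosure (V : Submodule ℂ (H →L[ℂ] H)) :
    (ultraweakClosure V : Set (H →L[ℂ] H)) = @closure _ (ultraweak H) V := rfl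

theorem le_ultraweakClosure (V : Submodule ℂ (H →L[ℂ] H)) : V ≤ ultraweakClosure V :=
  @subset_closure _ (ultraweak H) V

/-- The ultraweak topology restricted to a subspace. -/
@[reducible]
noncomputable def ultraweakOn (V : Submodule ℂ (H →L[ℂ] H)) : TopologicalSpace V :=
  (ultraweak H).induced Subtype.val

/-- A linear map between spaces of operators is normal if it is ultraweakly continuous. -/
def IsNormalMap {V : Submodule ℂ (H →L[ℂ] H)} {V' : Submodule ℂ (H' →L[ℂ] H')}
    (φ : V →ₗ[ℂ] V') : Prop :=
  Continuous[ultraweakOn V, ultraweakOn V'] φ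

/-- `T ↦ (A ↦ tr[T A])`, with `A` restricted to `V`. -/
noncomputable def restrictedPairing (V : Submodule ℂ (H →L[ℂ] H)) :
    TraceClass H →ₗ[ℂ] Module.Dual ℂ V :=
  (LinearMap.lcomp ℂ ℂ V.subtype).comp (tracePairing H)

/-- The predual `𝒯(H)/∼_V`, where `T ∼_V T'` iff `tr[T A] = tr[T' A]` for all `A ∈ V`. -/
abbrev Predual (V : Submodule ℂ (H →L[ℂ] H)) : Type _ :=
  TraceClass H ⧸ LinearMap.ker (restrictedPairing V)

/-- The class in `𝒯(H)/∼_V` of a trace-class operator. -/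
noncomputable def Predual.mk (V : Submodule ℂ (H →L[ℂ] H)) : TraceClass H →ₗ[ℂ] Predual V :=
  (LinearMap.ker (restrictedPairing V)).mkQ

/-- The duality pairing between `𝒯(H)/∼_V` and `V`, `⟨[T], A⟩ = tr[T A]`. -/
noncomputable def Predual.pairing (V : Submodule ℂ (H →L[ℂ] H)) :
    Predual V →ₗ[ℂ] Module.Dual ℂ V :=
  Submodule.liftQ _ (restrictedPairing V) le_rfl

@[simp]
theorem Predual.pairing_mk (V : Submodule ℂ (H →L[ℂ] H)) (T : TraceClass H) (A : V) :
    Predual.pairing V (Predual.mk V T) A = tracePairing H T A := rfl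

theorem Predual.pairing_injective (V : Submodule ℂ (H →L[ℂ] H)) :
    Function.Injective (Predual.pairing V) := by
  rw [← LinearMap.ker_eq_bot]
  exact Submodule.ker_liftQ_eq_bot _ _ _ le_rfl

theorem exists_predual {V : Submodule ℂ (H →L[ℂ] H)} {V' : Submodule ℂ (H' →L[ℂ] H')}
    (φ : V →ₗ[ℂ] V') (hφ : IsNormalMap φ) (t : Predual V') :
    Predual.pairing V' t ∘ₗ φ ∈ LinearMap.range (Predual.pairing V) := by
  obtain ⟨T, rfl⟩ := Submodule.mkQ_surjective _ t
  have h : (restrictedPairing V' T ∘ₗ φ) ∈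
      Submodule.span ℂ (Set.range fun T : TraceClass H => restrictedPairing V T) := by
    rw [LinearMap.mem_span_iff_continuous]
    have e : ultraweakOn V =
        ⨅ T : TraceClass H, TopologicalSpace.induced (restrictedPairing V T) inferInstance := by
      simp only [ultraweakOn, ultraweak, induced_iInf, induced_compose]; rfl
    rw [← e]
    have c1 : Continuous[ultraweak H', inferInstance] (tracePairing H' T) :=
      continuous_iInf_dom continuous_induced_dom
    exact @Continuous.comp _ _ _ (ultraweakOn V) (ultraweak H') _ _ _ c1
      (@Continuous.comp _ _ _ (ultraweakOn V) (ultraweakOn V') (ultraweak H') _ _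
        continuous_induced_dom hφ)
  have h2 : (Set.range fun T : TraceClass H => restrictedPairing V T) =
      (LinearMap.range (restrictedPairing V) : Set (Module.Dual ℂ V)) := rfl
  rw [h2, Submodule.span_eq] at h
  obtain ⟨S, hS⟩ := h
  exact ⟨Predual.mk V S, hS⟩

/-- The predual map `φ_* : 𝒯(H')/∼_V' → 𝒯(H)/∼_V` of a normal map `φ : V → V'`, determined by
`⟨φ_* t, A⟩ = ⟨t, φ A⟩` for `A ∈ V`. -/
noncomputable def predualMap {V : Submodule ℂ (H →L[ℂ] H)} {V' : Submodule ℂ (H' →L[ℂ] H')}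
    (φ : V →ₗ[ℂ] V') (hφ : IsNormalMap φ) : Predual V' →ₗ[ℂ] Predual V :=
  (LinearEquiv.ofInjective _ (Predual.pairing_injective V)).symm.toLinearMap ∘ₗ
    LinearMap.codRestrict _ ((LinearMap.lcomp ℂ ℂ φ).comp (Predual.pairing V'))
      (exists_predual φ hφ)

theorem pairing_predualMap {V : Submodule ℂ (H →L[ℂ] H)} {V' : Submodule ℂ (H' →L[ℂ] H')}
    (φ : V →ₗ[ℂ] V') (hφ : IsNormalMap φ) (t : Predual V') (A : V) :
    Predual.pairing V (predualMap φ hφ t) A = Predual.pairing V' t (φ A) := by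
  have := LinearEquiv.ofInjective_symm_apply (f := Predual.pairing V)
    (h := Predual.pairing_injective V) (LinearMap.codRestrict _ ((LinearMap.lcomp ℂ ℂ φ).comp (Predual.pairing V'))
      (exists_predual φ hφ) t)
  exact congrArg (fun f => f A) this

/-- The predual of a linear map `f : V ⇀ V'` defined on a linear subspace of `V`: its graph consists
of the pairs `(t', t)` with `⟨t, A⟩ = ⟨t', f A⟩` for all `A` in the domain of `f`, so that its
domain is the set of those `t'` for which such a `t` exists. (As for adjoints of unbounded operators,
`t` is unique when the domain of `f` is ultraweakly dense in `V`.) -/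
noncomputable def partialPredual {V : Submodule ℂ (H →L[ℂ] H)} {V' : Submodule ℂ (H' →L[ℂ] H')}
    (f : V →ₗ.[ℂ] V') : Predual V' →ₗ.[ℂ] Predual V :=
  Submodule.toLinearPMap
    { carrier := {p | ∀ A : f.domain, Predual.pairing V p.2 A = Predual.pairing V' p.1 (f A)}
      zero_mem' := by simp
      add_mem' := fun {p q} hp hq A => by simp [hp A, hq A]
      smul_mem' := fun c p hp A => by simp [hp A] }

end Predual

section Systems

variable {G : Type*} [Group G] [TopologicalSpace G]

/-- A unitary representation `U` of `G` on `H` for which the action `g.A = U(g) A U(g)^*` on `B(H)`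
is ultraweakly continuous. -/
structure UnitaryRep (G : Type*) [Group G] [TopologicalSpace G]
    (H : Type*) [NormedAddCommGroup H] [InnerProductSpace ℂ H] [CompleteSpace H] where
  /-- the homomorphism into the unitary group -/
  U : G →* unitary (H →L[ℂ] H)
  continuous_act : ∀ A : H →L[ℂ] H, Continuous[inferInstance, ultraweak H]
    fun g : G => (U g : H →L[ℂ] H) * A * star (U g : H →L[ℂ] H)

/-- The action `g.A = U(g) A U(g)^*`. -/
noncomputable def UnitaryRep.act {H : Type*} [NormedAddCommGroup H] [InnerProductSpace ℂ H]
    [CompleteSpace H] (u : UnitaryRep G H) (g : G) (A : H →L[ℂ] H) : H →L[ℂ] H :=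
  (u.U g : H →L[ℂ] H) * A * star (u.U g : H →L[ℂ] H)

/-- A semi-quantum system: an ultraweakly closed subspace `V ⊆ B(H)` containing the identity and
stable under the action of `G` coming from a unitary representation on `H`. -/
structure SemiQuantumSystem (G : Type*) [Group G] [TopologicalSpace G]
    (H : Type*) [NormedAddCommGroup H] [InnerProductSpace ℂ H] [CompleteSpace H] where
  /-- the unitary representation -/
  rep : UnitaryRep G H
  /-- the space of operators -/
  V : Submodule ℂ (H →L[ℂ] H)
  isClosed : IsClosed[ultraweak H] (V : Set (H →L[ℂ] H))
  one_mem : (1 : H →L[ℂ] H) ∈ V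
  act_mem : ∀ g : G, ∀ A ∈ V, rep.act g A ∈ V

/-- A semi-quantum channel: a normal positive unital linear map `V → V'`. -/
structure Channel {H H' : Type*} [NormedAddCommGroup H] [InnerProductSpace ℂ H] [CompleteSpace H]
    [NormedAddCommGroup H'] [InnerProductSpace ℂ H'] [CompleteSpace H']
    (S : SemiQuantumSystem G H) (S' : SemiQuantumSystem G H') where
  /-- the underlying linear map -/
  toLin : S.V →ₗ[ℂ] S'.V
  normal : IsNormalMap toLin
  positive : ∀ A : S.V, (A : H →L[ℂ] H).IsPositive → (toLin A : H' →L[ℂ] H').IsPositive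
  unital : (toLin ⟨1, S.one_mem⟩ : H' →L[ℂ] H') = 1

/-- The identity channel. -/
def Channel.id {H : Type*} [NormedAddCommGroup H] [InnerProductSpace ℂ H] [CompleteSpace H]
    (S : SemiQuantumSystem G H) : Channel S S where
  toLin := LinearMap.id
  normal := @continuous_id _ (ultraweakOn S.V)
  positive _ h := h
  unital := rfl

/-- The predual map of a channel. -/
noncomputable def Channel.predual {H H' : Type*} [NormedAddCommGroup H] [InnerProductSpace ℂ H]
    [CompleteSpace H] [NormedAddCommGroup H'] [InnerProductSpace ℂ H'] [CompleteSpace H']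
    {S : SemiQuantumSystem G H} {S' : SemiQuantumSystem G H'} (φ : Channel S S') :
    Predual S'.V →ₗ[ℂ] Predual S.V :=
  predualMap φ.toLin φ.normal

/-- A principal semi-quantum reference frame: a semi-quantum system together with a positive
operator-valued measure `E` on the Borel sets of `G` which is covariant and has its effects in `V`.
Only the values of `E` on Borel sets matter. -/
structure Frame (G : Type*) [Group G] [TopologicalSpace G] [MeasurableSpace G]
    (H : Type*) [NormedAddCommGroup H] [InnerProductSpace ℂ H] [CompleteSpace H]
    extends SemiQuantumSystem G H where
  /-- the frame observable -/
  E : Set G → (H →L[ℂ] H)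
  E_pos : ∀ X, MeasurableSet X → (E X).IsPositive
  E_univ : E Set.univ = 1
  E_empty : E ∅ = 0
  E_iUnion : ∀ X : ℕ → Set G, (∀ n, MeasurableSet (X n)) → Pairwise (Function.onFun Disjoint X) →
    ∀ T : TraceClass H,
      HasSum (fun n => tracePairing H T (E (X n))) (tracePairing H T (E (⋃ n, X n)))
  E_covariant : ∀ (g : G) (X : Set G), MeasurableSet X → E ((g * ·) '' X) = rep.act g (E X)
  E_mem : ∀ X, MeasurableSet X → E X ∈ V

/-- A morphism of principal semi-quantum frames `R → R'`: a semi-quantum channel `ψ : V_R → V_R'`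
such that `E_R'(X) = ψ(E_R(X))` for all Borel sets `X`. -/
structure FrameMorphism [MeasurableSpace G] {H H' : Type*} [NormedAddCommGroup H]
    [InnerProductSpace ℂ H] [CompleteSpace H] [NormedAddCommGroup H'] [InnerProductSpace ℂ H']
    [CompleteSpace H'] (R : Frame G H) (R' : Frame G H')
    extends Channel R.toSemiQuantumSystem R'.toSemiQuantumSystem where
  map_E : ∀ (X : Set G) (hX : MeasurableSet X),
    R'.E X = (toLin ⟨R.E X, R.E_mem X hX⟩ : H' →L[ℂ] H')

end Systems

section Tensor

open scoped TensorProduct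

variable {H K : Type*} [NormedAddCommGroup H] [InnerProductSpace ℂ H]
  [NormedAddCommGroup K] [InnerProductSpace ℂ K]

/-- The Hilbert space tensor product. -/
abbrev HTensor (H K : Type*) [NormedAddCommGroup H] [InnerProductSpace ℂ H]
    [NormedAddCommGroup K] [InnerProductSpace ℂ K] : Type _ :=
  UniformSpace.Completion (H ⊗[ℂ] K)

/-- The simple tensor `x ⊗ y` in the Hilbert space tensor product. -/
noncomputable def htmul (x : H) (y : K) : HTensor H K :=
  ((x ⊗ₜ[ℂ] y : H ⊗[ℂ] K) : UniformSpace.Completion (H ⊗[ℂ] K))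

/-- The tensor product `A ⊗ B` of bounded operators. -/
noncomputable def tensorOp (A : H →L[ℂ] H) (B : K →L[ℂ] K) : HTensor H K →L[ℂ] HTensor H K :=
  (TensorProduct.mapL A B).completion

@[simp]
theorem tensorOp_htmul (A : H →L[ℂ] H) (B : K →L[ℂ] K) (x : H) (y : K) :
    tensorOp A B (htmul x y) = htmul (A x) (B y) := by
  simp [tensorOp, htmul]

@[simp]
theorem inner_htmul (x x' : H) (y y' : K) :
    ⟪htmul x y, htmul x' y'⟫_ℂ = ⟪x, x'⟫_ℂ * ⟪y, y'⟫_ℂ := by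
  simp [htmul]

theorem norm_htmul (x : H) (y : K) : ‖htmul x y‖ = ‖x‖ * ‖y‖ := by
  simp [htmul]

theorem htmul_add_left (x x' : H) (y : K) : htmul (x + x') y = htmul x y + htmul x' y := by
  simp [htmul, TensorProduct.add_tmul, UniformSpace.Completion.coe_add]

theorem htmul_smul_left (c : ℂ) (x : H) (y : K) : htmul (c • x) y = c • htmul x y := by
  rw [htmul, htmul, ← UniformSpace.Completion.coe_smul, TensorProduct.smul_tmul']

theorem htmul_add_right (x : H) (y y' : K) : htmul x (y + y') = htmul x y + htmul x y' := by
  simp [htmul, TensorProduct.tmul_add, UniformSpace.Completion.coe_add]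

theorem htmul_smul_right (c : ℂ) (x : H) (y : K) : htmul x (c • y) = c • htmul x y := by
  rw [htmul, htmul, ← UniformSpace.Completion.coe_smul, TensorProduct.tmul_smul]

theorem htmul_induction {p : HTensor H K → Prop} (z : HTensor H K) (hc : IsClosed {z | p z})
    (h : ∀ x y, p (htmul x y)) (ha : ∀ z w, p z → p w → p (z + w)) : p z := by
  refine UniformSpace.Completion.induction_on z hc fun t => ?_
  induction t using TensorProduct.induction_on with
  | zero => simpa [htmul] using h 0 0
  | tmul x y => exact h x y
  | add a b hA hB => rw [UniformSpace.Completion.coe_add]; exact ha _ _ hA hB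

theorem op_ext_htmul {E : Type*} [NormedAddCommGroup E] [InnerProductSpace ℂ E]
    {A B : HTensor H K →L[ℂ] E} (h : ∀ x y, A (htmul x y) = B (htmul x y)) : A = B := by
  ext z
  refine htmul_induction z (isClosed_eq A.continuous B.continuous) h fun z w hz hw => ?_
  rw [map_add, map_add, hz, hw]

theorem op_ext_inner {A B : HTensor H K →L[ℂ] HTensor H K}
    (h : ∀ x y x' y', ⟪htmul x' y', A (htmul x y)⟫_ℂ = ⟪htmul x' y', B (htmul x y)⟫_ℂ) :
    A = B := by
  refine op_ext_htmul fun x y => ext_inner_left ℂ fun z => ?_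
  refine htmul_induction (p := fun z => ⟪z, A (htmul x y)⟫_ℂ = ⟪z, B (htmul x y)⟫_ℂ) z
    (isClosed_eq (by fun_prop) (by fun_prop)) (fun x' y' => h x y x' y') ?_
  intro z w hz hw
  rw [inner_add_left, inner_add_left, hz, hw]

theorem op_ext_diag {A B : HTensor H K →L[ℂ] HTensor H K}
    (h : ∀ x y y', ⟪htmul x y', A (htmul x y)⟫_ℂ = ⟪htmul x y', B (htmul x y)⟫_ℂ) : A = B := by
  refine op_ext_inner fun x y x' y' => ?_
  have key : ∀ C : HTensor H K →L[ℂ] HTensor H K, 4 * ⟪htmul x' y', C (htmul x y)⟫_ℂ =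
      ⟪htmul (x' + x) y', C (htmul (x' + x) y)⟫_ℂ - ⟪htmul (x' + (-1 : ℂ) • x) y', C (htmul (x' + (-1 : ℂ) • x) y)⟫_ℂ
      - Complex.I * ⟪htmul (x' + Complex.I • x) y', C (htmul (x' + Complex.I • x) y)⟫_ℂ
      + Complex.I * ⟪htmul (x' + (-Complex.I) • x) y', C (htmul (x' + (-Complex.I) • x) y)⟫_ℂ := by
    intro C
    simp only [htmul_add_left, htmul_smul_left, map_add, map_smul, inner_add_left, inner_add_right,
      inner_smul_left, inner_smul_right, map_neg, Complex.conj_I, map_one]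
    ring_nf
    simp only [Complex.I_sq]
    ring
  have e : (4 : ℂ) ≠ 0 := by norm_num
  apply mul_left_cancel₀ e
  rw [key A, key B]
  simp only [h]

theorem tensorOp_mul (A A' : H →L[ℂ] H) (B B' : K →L[ℂ] K) :
    tensorOp (A * A') (B * B') = tensorOp A B * tensorOp A' B' := by
  refine op_ext_htmul fun x y => ?_
  simp

theorem norm_tensorOp_le (A : H →L[ℂ] H) (B : K →L[ℂ] K) : ‖tensorOp A B‖ ≤ ‖A‖ * ‖B‖ := by
  refine ContinuousLinearMap.opNorm_le_bound _ (by positivity) fun z => ?_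
  refine UniformSpace.Completion.induction_on z (isClosed_le (by fun_prop) (by fun_prop))
    fun t => ?_
  have : tensorOp A B (t : UniformSpace.Completion (H ⊗[ℂ] K)) = (TensorProduct.mapL A B t : _) := by
    simp [tensorOp]
  rw [this, UniformSpace.Completion.norm_coe, UniformSpace.Completion.norm_coe]
  refine ((TensorProduct.mapL A B).le_opNorm t).trans ?_
  gcongr
  exact TensorProduct.norm_mapL_le A B

theorem tensorOp_rankOne (x y : H) (u v : K) :
    tensorOp (rankOne ℂ x y) (rankOne ℂ u v) = rankOne ℂ (htmul x u) (htmul y v) := by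
  refine op_ext_htmul fun z w => ?_
  rw [tensorOp_htmul, rankOne_apply, rankOne_apply, rankOne_apply, htmul_smul_left,
    htmul_smul_right, smul_smul, inner_htmul]

theorem tensorOp_add_left (A A' : H →L[ℂ] H) (B : K →L[ℂ] K) :
    tensorOp (A + A') B = tensorOp A B + tensorOp A' B := by
  refine op_ext_htmul fun x y => ?_
  rw [_root_.add_apply, tensorOp_htmul, tensorOp_htmul, tensorOp_htmul,
    _root_.add_apply, htmul_add_left]

theorem tensorOp_add_right (A : H →L[ℂ] H) (B B' : K →L[ℂ] K) :
    tensorOp A (B + B') = tensorOp A B + tensorOp A B' := by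
  refine op_ext_htmul fun x y => ?_
  rw [_root_.add_apply, tensorOp_htmul, tensorOp_htmul, tensorOp_htmul,
    _root_.add_apply, htmul_add_right]

theorem tensorOp_smul_left (c : ℂ) (A : H →L[ℂ] H) (B : K →L[ℂ] K) :
    tensorOp (c • A) B = c • tensorOp A B := by
  refine op_ext_htmul fun x y => ?_
  rw [_root_.smul_apply, tensorOp_htmul, tensorOp_htmul,
    _root_.smul_apply, htmul_smul_left]

theorem tensorOp_smul_right (c : ℂ) (A : H →L[ℂ] H) (B : K →L[ℂ] K) :
    tensorOp A (c • B) = c • tensorOp A B := by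
  refine op_ext_htmul fun x y => ?_
  rw [_root_.smul_apply, tensorOp_htmul, tensorOp_htmul,
    _root_.smul_apply, htmul_smul_right]

theorem continuous_tensorOp_left (B : K →L[ℂ] K) :
    Continuous fun A : H →L[ℂ] H => tensorOp A B := by
  have : LipschitzWith ‖B‖₊ fun A : H →L[ℂ] H => tensorOp A B := by
    refine LipschitzWith.of_dist_le_mul fun A A' => ?_
    have e : tensorOp A B - tensorOp A' B = tensorOp (A - A') B := by
      rw [sub_eq_iff_eq_add, ← tensorOp_add_left, sub_add_cancel]
    rw [dist_eq_norm, dist_eq_norm, e, mul_comm]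
    exact norm_tensorOp_le _ _
  exact this.continuous

theorem continuous_tensorOp_right (A : H →L[ℂ] H) :
    Continuous fun B : K →L[ℂ] K => tensorOp A B := by
  have : LipschitzWith ‖A‖₊ fun B : K →L[ℂ] K => tensorOp A B := by
    refine LipschitzWith.of_dist_le_mul fun B B' => ?_
    have e : tensorOp A B - tensorOp A B' = tensorOp A (B - B') := by
      rw [sub_eq_iff_eq_add, ← tensorOp_add_right, sub_add_cancel]
    rw [dist_eq_norm, dist_eq_norm, e]
    exact norm_tensorOp_le _ _
  exact this.continuous

theorem hasSum_tensorOp_left {ι : Type*} {f : ι → H →L[ℂ] H} {A : H →L[ℂ] H} (h : HasSum f A)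
    (B : K →L[ℂ] K) : HasSum (fun i => tensorOp (f i) B) (tensorOp A B) := by
  let φ : (H →L[ℂ] H) →+ (HTensor H K →L[ℂ] HTensor H K) :=
    AddMonoidHom.mk' (fun A => tensorOp A B) fun A A' => tensorOp_add_left A A' B
  have hφ : Continuous φ := continuous_tensorOp_left B
  exact h.map φ hφ

theorem hasSum_tensorOp_right {ι : Type*} {f : ι → K →L[ℂ] K} {B : K →L[ℂ] K} (h : HasSum f B)
    (A : H →L[ℂ] H) : HasSum (fun i => tensorOp A (f i)) (tensorOp A B) := by
  let φ : (K →L[ℂ] K) →+ (HTensor H K →L[ℂ] HTensor H K) :=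
    AddMonoidHom.mk' (fun B => tensorOp A B) fun B B' => tensorOp_add_right A B B'
  have hφ : Continuous φ := continuous_tensorOp_right A
  exact h.map φ hφ

theorem IsTraceClass.tensor {S : H →L[ℂ] H} {T : K →L[ℂ] K} (hS : IsTraceClass S)
    (hT : IsTraceClass T) : IsTraceClass (tensorOp S T) := by
  obtain ⟨x, y, h, h'⟩ := hS
  obtain ⟨u, v, k, k'⟩ := hT
  have hs : Summable fun p : ℕ × ℕ => ‖htmul (x p.1) (u p.2)‖ * ‖htmul (y p.1) (v p.2)‖ := by
    have := h.mul_of_nonneg k (fun _ => by positivity) (fun _ => by positivity)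
    refine this.congr fun p => ?_
    simp only [norm_htmul]; ring
  have hsum : Summable fun p : ℕ × ℕ =>
      rankOne ℂ (htmul (x p.1) (u p.2)) (htmul (y p.1) (v p.2)) :=
    Summable.of_norm (by simpa using hs)
  have hlim : HasSum (fun p : ℕ × ℕ =>
      rankOne ℂ (htmul (x p.1) (u p.2)) (htmul (y p.1) (v p.2))) (tensorOp S T) := by
    have h1 : ∀ n, HasSum (fun m => rankOne ℂ (htmul (x n) (u m)) (htmul (y n) (v m)))
        (tensorOp (rankOne ℂ (x n) (y n)) T) := by
      intro n
      have := hasSum_tensorOp_right k' (rankOne ℂ (x n) (y n))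
      simpa only [tensorOp_rankOne] using this
    have h2 : HasSum (fun n => tensorOp (rankOne ℂ (x n) (y n)) T) (tensorOp S T) :=
      hasSum_tensorOp_left h' T
    have h3 := hsum.hasSum.prod_fiberwise h1
    rw [h2.unique h3]
    exact hsum.hasSum
  refine ⟨fun n => htmul (x (Nat.pairEquiv.symm n).1) (u (Nat.pairEquiv.symm n).2),
    fun n => htmul (y (Nat.pairEquiv.symm n).1) (v (Nat.pairEquiv.symm n).2), ?_, ?_⟩
  · exact (Nat.pairEquiv.symm.summable_iff
      (f := fun p : ℕ × ℕ => ‖htmul (x p.1) (u p.2)‖ * ‖htmul (y p.1) (v p.2)‖)).2 hs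
  · exact (Nat.pairEquiv.symm.hasSum_iff (f := fun p : ℕ × ℕ =>
      rankOne ℂ (htmul (x p.1) (u p.2)) (htmul (y p.1) (v p.2)))).2 hlim

variable [CompleteSpace H] [CompleteSpace K]

/-- The tensor product `S ⊗ T` of trace-class operators. -/
noncomputable def TraceClass.tensor (S : TraceClass H) (T : TraceClass K) :
    TraceClass (HTensor H K) :=
  ⟨tensorOp S T, IsTraceClass.tensor S.2 T.2⟩

end Tensor

section Relativization

variable {H K : Type*} [NormedAddCommGroup H] [InnerProductSpace ℂ H] [CompleteSpace H]
  [NormedAddCommGroup K] [InnerProductSpace ℂ K] [CompleteSpace K]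

theorem isTraceClass_rankOne (x y : H) : IsTraceClass (rankOne ℂ x y) := by
  refine ⟨Pi.single 0 x, Pi.single 0 y, ?_, ?_⟩
  · refine summable_of_ne_finset_zero (s := {0}) fun n hn => ?_
    simp [Pi.single_eq_of_ne (by simpa using hn : n ≠ 0)]
  · have := hasSum_single (f := fun n : ℕ => rankOne ℂ ((Pi.single 0 x : ℕ → H) n)
      ((Pi.single 0 y : ℕ → H) n)) 0 fun n hn => by simp [Pi.single_eq_of_ne hn]
    simpa using this

theorem opTrace_rankOne (x y : H) : opTrace (rankOne ℂ x y) = ⟪y, x⟫_ℂ := by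
  have h := (basis H).hasSum_inner_mul_inner y x
  rw [opTrace, ← h.tsum_eq]
  simp

theorem tracePairing_rankOne (x y : H) (A : H →L[ℂ] H) :
    tracePairing H ⟨rankOne ℂ x y, isTraceClass_rankOne x y⟩ A = ⟪y, A x⟫_ℂ := by
  change opTrace (rankOne ℂ x y * A) = _
  rw [← opTrace_mul_comm (isTraceClass_rankOne x y), ContinuousLinearMap.mul_def, comp_rankOne,
    opTrace_rankOne]

theorem inner_tensorOp_left (A : H →L[ℂ] H) (B : K →L[ℂ] K) (z w : HTensor H K) :
    ⟪tensorOp A B z, w⟫_ℂ = ⟪z, tensorOp A.adjoint B.adjoint w⟫_ℂ := by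
  refine htmul_induction (p := fun z => ⟪tensorOp A B z, w⟫_ℂ = ⟪z, tensorOp A.adjoint B.adjoint w⟫_ℂ)
    z (isClosed_eq (by fun_prop) (by fun_prop)) (fun x y => ?_) ?_
  · refine htmul_induction
      (p := fun w => ⟪tensorOp A B (htmul x y), w⟫_ℂ =
        ⟪htmul x y, tensorOp A.adjoint B.adjoint w⟫_ℂ)
      w (isClosed_eq (by fun_prop) (by fun_prop)) (fun x' y' => ?_) ?_
    · simp [ContinuousLinearMap.adjoint_inner_right]
    · intro u v hu hv
      rw [map_add, inner_add_right, inner_add_right, hu, hv]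
  · intro u v hu hv
    rw [map_add, inner_add_left, inner_add_left, hu, hv]

theorem norm_sum_tensorOp_le {ι : Type*} (s : Finset ι) (E : ι → H →L[ℂ] H) (A : ι → K →L[ℂ] K)
    (hE : ∀ i ∈ s, (E i).IsPositive) (h1 : ∑ i ∈ s, E i = 1) (c : ℝ) (hc : 0 ≤ c)
    (hA : ∀ i ∈ s, ‖A i‖ ≤ c) : ‖∑ i ∈ s, tensorOp (E i) (A i)‖ ≤ c := by
  let r : ι → H →L[ℂ] H := fun i => CFC.sqrt (E i)
  have hr : ∀ i ∈ s, r i * r i = E i := fun i hi =>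
    CFC.sqrt_mul_sqrt_self (E i) ((ContinuousLinearMap.nonneg_iff_isPositive _).2 (hE i hi))
  have hra : ∀ i, (r i).adjoint = r i := fun i =>
    (ContinuousLinearMap.isSelfAdjoint_iff'.1 (IsSelfAdjoint.of_nonneg (CFC.sqrt_nonneg (E i))))
  have hR : ∀ i z w, ⟪tensorOp (r i) (1 : K →L[ℂ] K) z, w⟫_ℂ = ⟪z, tensorOp (r i) 1 w⟫_ℂ := by
    intro i z w
    rw [inner_tensorOp_left, hra]
    congr 3
    exact ContinuousLinearMap.isSelfAdjoint_iff'.1 (IsSelfAdjoint.one _)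
  have hsq : ∀ z : HTensor H K, ∑ i ∈ s, ‖tensorOp (r i) (1 : K →L[ℂ] K) z‖ ^ 2 = ‖z‖ ^ 2 := by
    intro z
    have h2 : ∑ i ∈ s, tensorOp (E i) (1 : K →L[ℂ] K) = 1 := by
      refine op_ext_htmul fun x y => ?_
      have : ∑ i ∈ s, htmul (E i x) y = htmul (∑ i ∈ s, E i x) y := by
        let f : H →+ HTensor H K := AddMonoidHom.mk' (fun x => htmul x y) fun a b =>
          htmul_add_left a b y
        exact (map_sum f _ _).symm
      have e := congrArg (fun T : H →L[ℂ] H => T x) h1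
      simp only [_root_.sum_apply, tensorOp_htmul] at e ⊢
      simp only [_root_.one_apply_eq_self] at e ⊢
      rw [this, e]
    have h3 : ∀ i ∈ s, ((‖tensorOp (r i) (1 : K →L[ℂ] K) z‖ ^ 2 : ℝ) : ℂ) =
        ⟪z, tensorOp (E i) (1 : K →L[ℂ] K) z⟫_ℂ := by
      intro i hi
      have := inner_self_eq_norm_sq_to_K (𝕜 := ℂ) (tensorOp (r i) (1 : K →L[ℂ] K) z)
      rw [hR, ← _root_.mul_apply_eq_comp, ← tensorOp_mul, hr i hi, one_mul] at this
      rw [this]; push_cast; rfl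
    have h4 : ((∑ i ∈ s, ‖tensorOp (r i) (1 : K →L[ℂ] K) z‖ ^ 2 : ℝ) : ℂ) = ((‖z‖ ^ 2 : ℝ) : ℂ) := by
      rw [Complex.ofReal_sum, Finset.sum_congr rfl h3, ← inner_sum]
      have e := congrArg (fun T : HTensor H K →L[ℂ] HTensor H K => T z) h2
      simp only [_root_.sum_apply, _root_.one_apply_eq_self] at e
      rw [e, inner_self_eq_norm_sq_to_K]; push_cast; rfl
    exact_mod_cast h4
  have key : ∀ z w : HTensor H K, ‖⟪z, (∑ i ∈ s, tensorOp (E i) (A i)) w⟫_ℂ‖ ≤ c * ‖z‖ * ‖w‖ := by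
    intro z w
    have h5 : ∀ i ∈ s, ‖⟪z, tensorOp (E i) (A i) w⟫_ℂ‖ ≤
        c * (‖tensorOp (r i) (1 : K →L[ℂ] K) z‖ * ‖tensorOp (r i) (1 : K →L[ℂ] K) w‖) := by
      intro i hi
      have e : tensorOp (E i) (A i) =
          tensorOp (r i) 1 * (tensorOp 1 (A i) * tensorOp (r i) 1) := by
        rw [← tensorOp_mul, ← tensorOp_mul, one_mul, one_mul, mul_one, hr i hi]
      rw [e, _root_.mul_apply_eq_comp, ← hR, _root_.mul_apply_eq_comp]
      refine (norm_inner_le_norm _ _).trans ?_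
      have h6 : ‖tensorOp (1 : H →L[ℂ] H) (A i) (tensorOp (r i) 1 w)‖ ≤
          c * ‖tensorOp (r i) (1 : K →L[ℂ] K) w‖ := by
        refine (ContinuousLinearMap.le_opNorm _ _).trans ?_
        gcongr
        refine (norm_tensorOp_le _ _).trans ?_
        have : ‖(1 : H →L[ℂ] H)‖ ≤ 1 := ContinuousLinearMap.norm_id_le
        calc _ ≤ 1 * c := mul_le_mul this (hA i hi) (norm_nonneg _) zero_le_one
          _ = c := one_mul c
      calc _ ≤ ‖tensorOp (r i) (1 : K →L[ℂ] K) z‖ * (c * ‖tensorOp (r i) (1 : K →L[ℂ] K) w‖) := by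
            gcongr
        _ = _ := by ring
    rw [_root_.sum_apply, inner_sum]
    refine (norm_sum_le _ _).trans ((Finset.sum_le_sum h5).trans ?_)
    rw [← Finset.mul_sum, mul_assoc]
    gcongr
    refine (Real.sum_mul_le_sqrt_mul_sqrt _ _ _).trans (le_of_eq ?_)
    rw [hsq, hsq, Real.sqrt_sq (norm_nonneg _), Real.sqrt_sq (norm_nonneg _)]
  refine ContinuousLinearMap.opNorm_le_bound _ hc fun w => ?_
  set v := (∑ i ∈ s, tensorOp (E i) (A i)) w with hv
  by_cases h0 : ‖v‖ = 0
  · rw [h0]; positivity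
  have := key v w
  rw [← hv, inner_self_eq_norm_sq_to_K] at this
  have h7 : ‖v‖ * ‖v‖ ≤ ‖v‖ * (c * ‖w‖) := by
    calc ‖v‖ * ‖v‖ = ‖((‖v‖ : ℂ)) ^ 2‖ := by rw [norm_pow, Complex.norm_real, norm_norm, sq]
      _ ≤ _ := this
      _ = _ := by ring
  exact le_of_mul_le_mul_left h7 (lt_of_le_of_ne (norm_nonneg _) (Ne.symm h0))

/-- A uniformly bounded sequence of operators has a weak limit along an ultrafilter. -/
theorem exists_ultrafilter_limit {L : Type*} [NormedAddCommGroup L] [InnerProductSpace ℂ L]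
    [CompleteSpace L] (B : ℕ → L →L[ℂ] L) (c : ℝ) (hB : ∀ n, ‖B n‖ ≤ c) :
    ∃ T : L →L[ℂ] L, ∀ z w : L, Filter.Tendsto (fun n => ⟪z, B n w⟫_ℂ)
      (Filter.hyperfilter ℕ : Filter ℕ) (𝓝 ⟪z, T w⟫_ℂ) := by
  have hb : ∀ z w n, ‖⟪z, B n w⟫_ℂ‖ ≤ c * ‖z‖ * ‖w‖ := by
    intro z w n
    refine (norm_inner_le_norm _ _).trans ?_
    calc ‖z‖ * ‖B n w‖ ≤ ‖z‖ * (c * ‖w‖) := by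
          gcongr; exact (B n).le_of_opNorm_le (hB n) w
      _ = _ := by ring
  have ex : ∀ z w, ∃ l : ℂ, ‖l‖ ≤ c * ‖z‖ * ‖w‖ ∧ Filter.Tendsto (fun n => ⟪z, B n w⟫_ℂ)
      (Filter.hyperfilter ℕ : Filter ℕ) (𝓝 l) := by
    intro z w
    obtain ⟨l, hl, h⟩ := (isCompact_closedBall (0 : ℂ) (c * ‖z‖ * ‖w‖)).ultrafilter_le_nhds
      ((Filter.hyperfilter ℕ).map fun n => ⟪z, B n w⟫_ℂ)
      (by
        rw [Filter.le_principal_iff]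
        refine Filter.mem_map.2 (Filter.univ_mem' fun n => ?_)
        simpa using hb z w n)
    exact ⟨l, by simpa using hl, h⟩
  choose F hF hlim using ex
  let form : L →ₗ⋆[ℂ] L →ₗ[ℂ] ℂ := LinearMap.mk₂'ₛₗ (starRingEnd ℂ) (RingHom.id ℂ) F
    (fun z z' w => tendsto_nhds_unique (hlim (z + z') w)
      (by simpa only [inner_add_left] using (hlim z w).add (hlim z' w)))
    (fun a z w => tendsto_nhds_unique (hlim (a • z) w)
      (by simpa only [inner_smul_left, smul_eq_mul] using (hlim z w).const_mul (starRingEnd ℂ a)))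
    (fun z w w' => tendsto_nhds_unique (hlim z (w + w'))
      (by simpa only [map_add, inner_add_right] using (hlim z w).add (hlim z w')))
    (fun a z w => tendsto_nhds_unique (hlim z (a • w))
      (by simpa only [map_smul, inner_smul_right, smul_eq_mul, RingHom.id_apply] using (hlim z w).const_mul a))
  let formL : L →L⋆[ℂ] L →L[ℂ] ℂ := form.mkContinuous₂ c fun z w => hF z w
  refine ⟨(InnerProductSpace.continuousLinearMapOfBilin formL).adjoint, fun z w => ?_⟩
  rw [ContinuousLinearMap.adjoint_inner_right,
    InnerProductSpace.continuousLinearMapOfBilin_apply]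
  exact hlim z w

end Relativization

section Yen

variable {G : Type*} [Group G] [TopologicalSpace G]
variable {H K : Type*} [NormedAddCommGroup H] [InnerProductSpace ℂ H] [CompleteSpace H]
  [NormedAddCommGroup K] [InnerProductSpace ℂ K] [CompleteSpace K]

theorem UnitaryRep.norm_act_le (u : UnitaryRep G K) (g : G) (A : K →L[ℂ] K) :
    ‖u.act g A‖ ≤ ‖A‖ := by
  have h1 : ‖(u.U g : K →L[ℂ] K)‖ ≤ 1 := by
    refine ContinuousLinearMap.opNorm_le_bound _ zero_le_one fun x => ?_
    have h := (Unitary.mem_iff.1 (u.U g).2).1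
    have e := congrArg (fun T : K →L[ℂ] K => ⟪x, T x⟫_ℂ) h
    simp only [_root_.mul_apply_eq_comp, ContinuousLinearMap.star_eq_adjoint,
      ContinuousLinearMap.adjoint_inner_right, _root_.one_apply_eq_self,
      inner_self_eq_norm_sq_to_K] at e
    have e' : ‖(u.U g : K →L[ℂ] K) x‖ ^ 2 = ‖x‖ ^ 2 := by exact_mod_cast e
    rw [one_mul]
    exact le_of_sq_le_sq e'.le (norm_nonneg _)
  have h2 : ‖star (u.U g : K →L[ℂ] K)‖ ≤ 1 := by rwa [norm_star]
  unfold UnitaryRep.act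
  calc _ ≤ ‖(u.U g : K →L[ℂ] K)‖ * ‖A‖ * ‖star (u.U g : K →L[ℂ] K)‖ :=
        (norm_mul_le _ _).trans (by gcongr; exact norm_mul_le _ _)
    _ ≤ 1 * ‖A‖ * 1 := by gcongr
    _ = ‖A‖ := by ring

theorem UnitaryRep.act_add (u : UnitaryRep G K) (g : G) (A B : K →L[ℂ] K) :
    u.act g (A + B) = u.act g A + u.act g B := by
  simp [UnitaryRep.act, mul_add, add_mul]

theorem UnitaryRep.act_smul (u : UnitaryRep G K) (g : G) (c : ℂ) (A : K →L[ℂ] K) :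
    u.act g (c • A) = c • u.act g A := by
  simp [UnitaryRep.act]

theorem UnitaryRep.continuous_inner_act (u : UnitaryRep G K) (A : K →L[ℂ] K) (y y' : K) :
    Continuous fun g : G => ⟪y', u.act g A y⟫_ℂ := by
  have h := u.continuous_act A
  have h2 : Continuous[ultraweak K, inferInstance]
      (tracePairing K ⟨rankOne ℂ y y', isTraceClass_rankOne y y'⟩) :=
    continuous_iInf_dom continuous_induced_dom
  have h3 := @Continuous.comp _ _ _ _ (ultraweak K) _ _ _ h2 h
  refine h3.congr fun g => ?_
  exact tracePairing_rankOne y y' _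

variable [MeasurableSpace G]

theorem Frame.inner_E_nonneg (R : Frame G H) {X : Set G} (hX : MeasurableSet X) (x : H) :
    ((⟪x, R.E X x⟫_ℂ).re : ℂ) = ⟪x, R.E X x⟫_ℂ ∧ 0 ≤ (⟪x, R.E X x⟫_ℂ).re := by
  have h := (R.E_pos X hX).inner_nonneg_right x
  rw [Complex.nonneg_iff] at h
  exact ⟨Complex.ext rfl (by simpa using h.2), h.1⟩

/-- The measure `X ↦ ⟪x, E(X) x⟫ = tr[|x⟩⟨x| E(X)]` on `G` given by the frame observable. -/
noncomputable def Frame.measure (R : Frame G H) (x : H) : Measure G :=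
  Measure.ofMeasurable (fun X _ => ENNReal.ofReal (⟪x, R.E X x⟫_ℂ).re)
    (by simp [R.E_empty])
    (fun X hX hd => by
      have h := R.E_iUnion X hX hd ⟨rankOne ℂ x x, isTraceClass_rankOne x x⟩
      simp only [tracePairing_rankOne] at h
      have h' := Complex.hasSum_re h
      rw [← h'.tsum_eq, ENNReal.ofReal_tsum_of_nonneg
        (fun n => (R.inner_E_nonneg (hX n) x).2) h'.summable])

theorem Frame.measure_apply (R : Frame G H) (x : H) {X : Set G} (hX : MeasurableSet X) :
    R.measure x X = ENNReal.ofReal (⟪x, R.E X x⟫_ℂ).re :=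
  Measure.ofMeasurable_apply X hX

instance Frame.isFiniteMeasure_measure (R : Frame G H) (x : H) : IsFiniteMeasure (R.measure x) :=
  ⟨by rw [R.measure_apply x MeasurableSet.univ]; exact ENNReal.ofReal_lt_top⟩

theorem Frame.measureReal_apply (R : Frame G H) (x : H) {X : Set G} (hX : MeasurableSet X) :
    ((R.measure x).real X : ℂ) = ⟪x, R.E X x⟫_ℂ := by
  rw [Measure.real, R.measure_apply x hX, ENNReal.toReal_ofReal (R.inner_E_nonneg hX x).2,
    (R.inner_E_nonneg hX x).1]

/-- `B = ∫_G dE(g) ⊗ g.A`, in the weak sense: for all `x, y, y'`,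
`⟪x ⊗ y', B (x ⊗ y)⟫ = ∫_G ⟪y', (g.A) y⟫ d⟪x, E(g) x⟫`. By polarization in `x` and density of the
span of simple tensors this determines `B`. -/
def IsRelativization (R : Frame G H) (u : UnitaryRep G K) (A : K →L[ℂ] K)
    (B : HTensor H K →L[ℂ] HTensor H K) : Prop :=
  ∀ (x : H) (y y' : K),
    ⟪htmul x y', B (htmul x y)⟫_ℂ = ∫ g, ⟪y', u.act g A y⟫_ℂ ∂(R.measure x)

theorem IsRelativization.unique {R : Frame G H} {u : UnitaryRep G K} {A : K →L[ℂ] K}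
    {B B' : HTensor H K →L[ℂ] HTensor H K} (h : IsRelativization R u A B)
    (h' : IsRelativization R u A B') : B = B' :=
  op_ext_diag fun x y y' => (h x y y').trans (h' x y y').symm

variable [BorelSpace G]

theorem Frame.integrable_act (R : Frame G H) (u : UnitaryRep G K) (A : K →L[ℂ] K) (x : H)
    (y y' : K) : Integrable (fun g => ⟪y', u.act g A y⟫_ℂ) (R.measure x) := by
  refine Integrable.of_bound
    (u.continuous_inner_act A y y').measurable.aestronglyMeasurable (‖y'‖ * (‖A‖ * ‖y‖)) ?_
  refine Filter.Eventually.of_forall fun g => (norm_inner_le_norm _ _).trans ?_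
  gcongr
  exact ContinuousLinearMap.le_of_opNorm_le _ (u.norm_act_le _ _) _

variable [IsTopologicalGroup G] [SecondCountableTopology G] [T2Space G]

theorem exists_isRelativization (R : Frame G H) (u : UnitaryRep G K) (A : K →L[ℂ] K) :
    ∃ B, IsRelativization R u A B := by
  let s : ℕ → SimpleFunc G G := (stronglyMeasurable_id (α := G)).approx
  have hs : ∀ g, Filter.Tendsto (fun n => s n g) Filter.atTop (𝓝 g) :=
    (stronglyMeasurable_id (α := G)).tendsto_approx
  let X : ℕ → G → Set G := fun n v => s n ⁻¹' {v}
  have hX : ∀ n v, MeasurableSet (X n v) := fun n v => (s n).measurableSet_fiber v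
  let B : ℕ → (HTensor H K →L[ℂ] HTensor H K) := fun n =>
    ∑ v ∈ (s n).range, tensorOp (R.E (X n v)) (u.act v A)
  have hone : ∀ n, ∑ v ∈ (s n).range, R.E (X n v) = 1 := by
    intro n
    rw [← ContinuousLinearMap.coe_inj, ← ext_inner_map]
    intro x
    have h1 : ∑ v ∈ (s n).range, (R.measure x).real (X n v) = (R.measure x).real Set.univ := by
      have := (s n).sum_range_measure_preimage_singleton (R.measure x)
      rw [Measure.real, ← this, ENNReal.toReal_sum fun _ _ => measure_ne_top _ _]
      rfl
    have h2 : ∑ v ∈ (s n).range, ⟪x, R.E (X n v) x⟫_ℂ = ⟪x, x⟫_ℂ := by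
      have h3 := congrArg (fun r : ℝ => (r : ℂ)) h1
      simp only [Complex.ofReal_sum, R.measureReal_apply x (hX n _),
        R.measureReal_apply x MeasurableSet.univ, R.E_univ] at h3
      exact h3
    have h4 := congrArg (starRingEnd ℂ) h2
    rw [← inner_sum, inner_conj_symm, inner_conj_symm] at h4
    simpa using h4
  have hB : ∀ n, ‖B n‖ ≤ ‖A‖ := fun n =>
    norm_sum_tensorOp_le _ _ _ (fun v _ => R.E_pos _ (hX n v)) (hone n) _ (norm_nonneg _)
      fun v _ => u.norm_act_le v A
  obtain ⟨T, hT⟩ := exists_ultrafilter_limit B ‖A‖ hB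
  refine ⟨T, fun x y y' => ?_⟩
  refine tendsto_nhds_unique (hT (htmul x y') (htmul x y)) ?_
  have hc := u.continuous_inner_act A y y'
  have hval : ∀ n, ⟪htmul x y', B n (htmul x y)⟫_ℂ =
      ∫ g, ⟪y', u.act (s n g) A y⟫_ℂ ∂(R.measure x) := by
    intro n
    have e : ∀ g, ⟪y', u.act (s n g) A y⟫_ℂ =
        ∑ v ∈ (s n).range, (X n v).indicator (fun _ => ⟪y', u.act v A y⟫_ℂ) g := by
      intro g
      rw [Finset.sum_eq_single (s n g)]
      · simp [X]
      · intro v _ hv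
        exact Set.indicator_of_notMem (fun h => hv (by simpa [X] using h.symm)) _
      · intro h
        exact absurd ((s n).mem_range_self g) h
    simp only [e]
    rw [integral_finsetSum _ fun v _ => (integrable_const _).indicator (hX n v)]
    simp only [integral_indicator_const _ (hX n _), B, _root_.sum_apply, inner_sum, tensorOp_htmul,
      inner_htmul]
    refine Finset.sum_congr rfl fun v _ => ?_
    rw [← R.measureReal_apply x (hX n v), Complex.real_smul]
  simp only [hval]
  have hlim : Filter.Tendsto (fun n => ∫ g, ⟪y', u.act (s n g) A y⟫_ℂ ∂(R.measure x)) Filter.atTop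
      (𝓝 (∫ g, ⟪y', u.act g A y⟫_ℂ ∂(R.measure x))) := by
    refine tendsto_integral_of_dominated_convergence (fun _ => ‖y'‖ * (‖A‖ * ‖y‖)) (fun n => ?_)
      (integrable_const _) (fun n => ?_) ?_
    · exact (hc.comp_stronglyMeasurable (s n).stronglyMeasurable).aestronglyMeasurable
    · refine Filter.Eventually.of_forall fun g => (norm_inner_le_norm _ _).trans ?_
      gcongr
      exact ContinuousLinearMap.le_of_opNorm_le _ (u.norm_act_le _ _) _
    · exact Filter.Eventually.of_forall fun g => (hc.tendsto g).comp (hs g)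
  exact hlim.mono_left (by rw [← Nat.cofinite_eq_atTop]; exact Filter.hyperfilter_le_cofinite)

/-- The relativization map `A ↦ ∫_G dE(g) ⊗ g.A`. -/
noncomputable def Frame.relativization (R : Frame G H) (u : UnitaryRep G K) :
    (K →L[ℂ] K) →ₗ[ℂ] (HTensor H K →L[ℂ] HTensor H K) where
  toFun A := Classical.choose (exists_isRelativization R u A)
  map_add' A A' := by
    refine IsRelativization.unique (Classical.choose_spec (exists_isRelativization R u (A + A')))
      fun x y y' => ?_
    simp only [u.act_add, _root_.add_apply, inner_add_right]
    rw [integral_add (R.integrable_act u A x y y') (R.integrable_act u A' x y y'),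
      Classical.choose_spec (exists_isRelativization R u A) x y y',
      Classical.choose_spec (exists_isRelativization R u A') x y y']
  map_smul' c A := by
    refine IsRelativization.unique (Classical.choose_spec (exists_isRelativization R u (c • A)))
      fun x y y' => ?_
    simp only [u.act_smul, _root_.smul_apply, inner_smul_right, RingHom.id_apply]
    rw [integral_const_mul, Classical.choose_spec (exists_isRelativization R u A) x y y']

theorem Frame.isRelativization_relativization (R : Frame G H) (u : UnitaryRep G K)
    (A : K →L[ℂ] K) : IsRelativization R u A (R.relativization u A) :=
  Classical.choose_spec (exists_isRelativization R u A)

/-- The space `V_S^R` of relative operators: the ultraweak closure of the image of `V_S` under the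
relativization map. -/
noncomputable def relOps (R : Frame G H) (S : SemiQuantumSystem G K) :
    Submodule ℂ (HTensor H K →L[ℂ] HTensor H K) :=
  ultraweakClosure (S.V.map (R.relativization S.rep))

/-- The relativization map of `R` as a map `V_S → V_S^R`. -/
noncomputable def relMap (R : Frame G H) (S : SemiQuantumSystem G K) : S.V →ₗ[ℂ] relOps R S :=
  ((R.relativization S.rep).domRestrict S.V).codRestrict (relOps R S) fun A =>
    le_ultraweakClosure _ (Submodule.mem_map_of_mem A.2)

/-- The product-relative state `ρ^(ω)`, as a relative state: the class of `ω ⊗ ρ` in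
`𝒯(H_R ⊗ H_S)/∼`, where operators are identified when they have the same expectation values on all
relative operators in `V_S^R`. -/
noncomputable def productRelative (R : Frame G H) (S : SemiQuantumSystem G K) (ω : TraceClass H)
    (ρ : TraceClass K) : Predual (relOps R S) :=
  Predual.mk (relOps R S) (TraceClass.tensor ω ρ)

variable {H' K' : Type*} [NormedAddCommGroup H'] [InnerProductSpace ℂ H'] [CompleteSpace H']
  [NormedAddCommGroup K'] [InnerProductSpace ℂ K'] [CompleteSpace K']

/-- The map `∫ dE_R(g) ⊗ g.A ↦ ∫ d(ψ ∘ E_R)(g) ⊗ g.φ(A)` induced by a frame morphism `ψ : R → R'` and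
a channel `φ : V_S → V_S'` on the ultraweakly dense subspace `{∫ dE_R(g) ⊗ g.A | A ∈ V_S}` of `V_S^R`.
Since `ψ ∘ E_R = E_R'`, its graph consists of the pairs
`(∫ dE_R(g) ⊗ g.A, ∫ dE_R'(g) ⊗ g.φ(A))` with `A ∈ V_S`. -/
noncomputable def yenMap {R : Frame G H} {R' : Frame G H'} (_ψ : FrameMorphism R R')
    {S : SemiQuantumSystem G K} {S' : SemiQuantumSystem G K'} (φ : Channel S S') :
    relOps R S →ₗ.[ℂ] relOps R' S' :=
  (LinearMap.range ((relMap R S).prod (relMap R' S' ∘ₗ φ.toLin))).toLinearPMap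

/-- The external frame transformation along a frame morphism `ψ : R → R'`: the predual of the map
induced by `ψ` and the identity channel of `S`. It leads from relative states with respect to `R'` to
relative states with respect to `R`. -/
noncomputable def externalTransformation {R : Frame G H} {R' : Frame G H'}
    (ψ : FrameMorphism R R') (S : SemiQuantumSystem G K) :
    Predual (relOps R' S) →ₗ.[ℂ] Predual (relOps R S) :=
  partialPredual (yenMap ψ (Channel.id S))

end Yen

section Reorientation

variable {G : Type*} [Group G] [TopologicalSpace G]
variable {H : Type*} [NormedAddCommGroup H] [InnerProductSpace ℂ H] [CompleteSpace H]

theorem UnitaryRep.act_mul (u : UnitaryRep G H) (g h : G) (A : H →L[ℂ] H) :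
    u.act (g * h) A = u.act g (u.act h A) := by
  simp [UnitaryRep.act, mul_assoc]

theorem UnitaryRep.act_one (u : UnitaryRep G H) (A : H →L[ℂ] H) : u.act 1 A = A := by
  simp [UnitaryRep.act]

theorem UnitaryRep.act_id (u : UnitaryRep G H) (g : G) : u.act g 1 = 1 := by
  simp [UnitaryRep.act]

theorem UnitaryRep.act_zero (u : UnitaryRep G H) (g : G) : u.act g 0 = 0 := by
  simp [UnitaryRep.act]

theorem UnitaryRep.act_isPositive (u : UnitaryRep G H) (g : G) {A : H →L[ℂ] H}
    (hA : A.IsPositive) : (u.act g A).IsPositive := by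
  have := hA.conj_adjoint (u.U g : H →L[ℂ] H)
  simpa [UnitaryRep.act, ContinuousLinearMap.mul_def, ContinuousLinearMap.star_eq_adjoint,
    ContinuousLinearMap.comp_assoc] using this

/-- The action on trace-class operators that is predual to `A ↦ h.A = U(h) A U(h)^*`, namely
`ω ↦ U(h)^* ω U(h)`. -/
noncomputable def UnitaryRep.predualAct (u : UnitaryRep G H) (h : G) (ω : TraceClass H) :
    TraceClass H :=
  ⟨star (u.U h : H →L[ℂ] H) * ω.1 * (u.U h : H →L[ℂ] H),
    IsTraceClass.comp_right (IsTraceClass.comp_left ω.2 _) _⟩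

theorem UnitaryRep.tracePairing_predualAct (u : UnitaryRep G H) (h : G) (ω : TraceClass H)
    (A : H →L[ℂ] H) :
    tracePairing H (u.predualAct h ω) A = tracePairing H ω (u.act h A) := by
  change opTrace (star (u.U h : H →L[ℂ] H) * ω.1 * (u.U h : H →L[ℂ] H) * A) =
    opTrace (ω.1 * ((u.U h : H →L[ℂ] H) * A * star (u.U h : H →L[ℂ] H)))
  have e : star (u.U h : H →L[ℂ] H) * ω.1 * (u.U h : H →L[ℂ] H) * A =
      star (u.U h : H →L[ℂ] H) * (ω.1 * ((u.U h : H →L[ℂ] H) * A)) := by simp only [mul_assoc]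
  rw [e, opTrace_mul_comm (IsTraceClass.comp_right ω.2 _)]
  simp only [mul_assoc]

theorem UnitaryRep.continuous_act_right (u : UnitaryRep G H) (h : G) :
    Continuous[ultraweak H, ultraweak H] (u.act h) := by
  refine continuous_iInf_rng.2 fun T => continuous_induced_rng.2 ?_
  have h1 : Continuous[ultraweak H, inferInstance] (tracePairing H (u.predualAct h T)) :=
    continuous_iInf_dom continuous_induced_dom
  convert h1 using 1
  funext A
  exact (u.tracePairing_predualAct h T A).symm

variable [IsTopologicalGroup G]

/-- The representation `g ↦ U(h) U(g) U(h)^* = U(h g h⁻¹)`. -/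
noncomputable def UnitaryRep.conj (u : UnitaryRep G H) (h : G) : UnitaryRep G H where
  U := u.U.comp (MulAut.conj h).toMonoidHom
  continuous_act A := by
    have hc : Continuous fun g : G => h * g * h⁻¹ := by fun_prop
    exact @Continuous.comp _ _ _ _ _ (ultraweak H) _ _ (u.continuous_act A) hc

theorem UnitaryRep.conj_act (u : UnitaryRep G H) (h g : G) (A : H →L[ℂ] H) :
    (u.conj h).act g A = u.act (h * g * h⁻¹) A := rfl

variable [MeasurableSpace G]

/-- The frame `h.R` obtained from `R` by the reorientation `h._ : V_R → V_R`: its observable is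
`X ↦ h.E(X)` on the same space `V_R`, covariant with respect to `g ↦ U(h) U(g) U(h)^*`. -/
noncomputable def Frame.reorient (R : Frame G H) (h : G) : Frame G H where
  rep := R.rep.conj h
  V := R.V
  isClosed := R.isClosed
  one_mem := R.one_mem
  act_mem g A hA := R.act_mem _ A hA
  E X := R.rep.act h (R.E X)
  E_pos X hX := R.rep.act_isPositive h (R.E_pos X hX)
  E_univ := by rw [R.E_univ, R.rep.act_id]
  E_empty := by rw [R.E_empty, R.rep.act_zero]
  E_iUnion X hX hd T := by
    have := R.E_iUnion X hX hd (R.rep.predualAct h T)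
    simpa only [UnitaryRep.tracePairing_predualAct] using this
  E_covariant g X hX := by
    rw [R.E_covariant g X hX, UnitaryRep.conj_act, ← UnitaryRep.act_mul, ← UnitaryRep.act_mul]
    simp
  E_mem X hX := R.act_mem h _ (R.E_mem X hX)

/-- The frame reorientation `h._ : V_R → V_R`, `A ↦ h.A`, as a frame morphism `R → h.R`. -/
noncomputable def Frame.reorientMorphism (R : Frame G H) (h : G) :
    FrameMorphism R (R.reorient h) where
  toLin :=
    { toFun := fun A => ⟨R.rep.act h A, R.act_mem h A A.2⟩
      map_add' := fun A B => Subtype.ext (R.rep.act_add h A B)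
      map_smul' := fun c A => Subtype.ext (R.rep.act_smul h c A) }
  normal := by
    refine continuous_induced_rng.2 ?_
    exact @Continuous.comp _ _ _ (ultraweakOn R.V) (ultraweak H) (ultraweak H) _ _
      (R.rep.continuous_act_right h) continuous_induced_dom
  positive A hA := R.rep.act_isPositive h hA
  unital := R.rep.act_id h
  map_E X hX := rfl

end Reorientation

end QRF

/-! The relativization `Y^R(A) = ∫ dE(g) ⊗ g.A` is the ultraweak limit of the bounded Riemann sums
`∑ᵥ E(s⁻¹{v}) ⊗ v.A`. On a product, `tr[(ω ⊗ ρ) Y^R(A)]` therefore depends on the frame and on `ω`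
only through `X ↦ tr[ω E(X)]`, and a frame morphism `ψ` matches these values for `ω'` and any
representative of `ψ_* ω'`. Taking rank-one `ω'` and `ρ` shows that `Y^R(A) = 0` forces
`Y^R'(A) = 0`, so `Y(ψ, id)` is well defined. Since `Y^R(V_S)` is ultraweakly dense, an element of
the predual is determined by its values there, which identifies the image of each
product-relative state. -/

namespace QRF

theorem isClosed_setOf_tendsto_of_norm_le {E F ι : Type*} [NormedAddCommGroup E] [NormedSpace ℂ E]
    [NormedAddCommGroup F] [NormedSpace ℂ F] {σ : ℂ →+* ℂ} [RingHomIsometric σ] {l : Filter ι}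
    {f : ι → E →SL[σ] F} {g : E → F} {c : ℝ} (hf : ∀ i x, ‖f i x‖ ≤ c * ‖x‖)
    (hg : Continuous g) : IsClosed {x | Filter.Tendsto (fun i => f i x) l (𝓝 (g x))} := by
  have heq : (∃ C, ∀ i x, ‖f i x‖ ≤ C * ‖x‖) ↔ Equicontinuous ((⇑) ∘ f) :=
    (NormedSpace.equicontinuous_TFAE f).out 3 1
  exact (heq.1 ⟨c, hf⟩).isClosed_setOfPred_tendsto hg

theorem integral_comp_simpleFunc {α β E : Type*} [MeasurableSpace α]
    [NormedAddCommGroup E] [NormedSpace ℝ E] [CompleteSpace E] (μ : Measure α) [IsFiniteMeasure μ]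
    (s : SimpleFunc α β) (φ : β → E) :
    ∫ g, φ (s g) ∂μ = ∑ v ∈ s.range, μ.real (s ⁻¹' {v}) • φ v := by
  have hcover : ⋃ v ∈ s.range, s ⁻¹' {v} = Set.univ :=
    Set.eq_univ_of_forall fun g => Set.mem_biUnion (s.mem_range_self g) rfl
  have hint : Integrable (fun g => φ (s g)) μ := (s.map φ).integrable_of_isFiniteMeasure
  rw [← setIntegral_univ, ← hcover, integral_biUnion_finset _
    (fun v _ => s.measurableSet_fiber v) (Set.pairwiseDisjoint_fiber s _)
    fun v _ => hint.integrableOn]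
  refine Finset.sum_congr rfl fun v _ => ?_
  rw [← setIntegral_const]
  exact setIntegral_congr_fun (s.measurableSet_fiber v) fun g hg => congrArg φ hg

section UltraweakTopology

variable {H : Type*} [NormedAddCommGroup H] [InnerProductSpace ℂ H] [CompleteSpace H]
variable {ι : Type*} {l : Filter ι}

theorem continuous_tracePairing (T : TraceClass H) :
    Continuous[ultraweak H, inferInstance] (tracePairing H T) :=
  continuous_iInf_dom continuous_induced_dom

theorem tendsto_ultraweak_iff {f : ι → H →L[ℂ] H} {A : H →L[ℂ] H} :
    Filter.Tendsto f l (@nhds _ (ultraweak H) A) ↔ ∀ T : TraceClass H,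
      Filter.Tendsto (fun i => tracePairing H T (f i)) l (𝓝 (tracePairing H T A)) := by
  simp only [nhds_iInf, nhds_induced, Filter.tendsto_iInf, Filter.tendsto_comap_iff,
    Function.comp_def]

theorem tracePairing_one (T : TraceClass H) : tracePairing H T 1 = opTrace (T : H →L[ℂ] H) :=
  congrArg opTrace (mul_one T.1)

theorem hasSum_inner_opTrace [Denumerable ι] {T : H →L[ℂ] H} {x y : ι → H}
    (hs : Summable fun i => ‖x i‖ * ‖y i‖) (hT : HasSum (fun i => rankOne ℂ (x i) (y i)) T) :
    HasSum (fun i => ⟪y i, x i⟫_ℂ) (opTrace T) := by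
  rw [← (Denumerable.eqv ι).symm.summable_iff] at hs
  rw [← (Denumerable.eqv ι).symm.hasSum_iff] at hT ⊢
  exact (hasSum_opTrace hs hT).2

theorem hasSum_inner_tracePairing (T : TraceClass H) {x y : ℕ → H}
    (hs : Summable fun n => ‖x n‖ * ‖y n‖)
    (hT : HasSum (fun n => rankOne ℂ (x n) (y n)) (T : H →L[ℂ] H)) (A : H →L[ℂ] H) :
    HasSum (fun n => ⟪y n, A (x n)⟫_ℂ) (tracePairing H T A) := by
  have hTA : HasSum (fun n => rankOne ℂ (x n) (A.adjoint (y n))) (T.1 * A) := by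
    simpa only [ContinuousLinearMap.mul_def, rankOne_comp] using hT.mul_right A
  have hsA : Summable fun n => ‖x n‖ * ‖A.adjoint (y n)‖ := by
    refine (hs.mul_left ‖A.adjoint‖).of_nonneg_of_le (fun n => by positivity) fun n => ?_
    rw [mul_left_comm]
    gcongr
    exact A.adjoint.le_opNorm _
  have hsum := hasSum_inner_opTrace hsA hTA
  simp only [ContinuousLinearMap.adjoint_inner_left] at hsum
  exact hsum

theorem tendsto_ultraweak_of_bounded {B : ι → H →L[ℂ] H} {A : H →L[ℂ] H} {c : ℝ}
    (hB : ∀ i, ‖B i‖ ≤ c)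
    (hlim : ∀ x y, Filter.Tendsto (fun i => ⟪y, B i x⟫_ℂ) l (𝓝 ⟪y, A x⟫_ℂ)) :
    Filter.Tendsto B l (@nhds _ (ultraweak H) A) := by
  refine tendsto_ultraweak_iff.2 fun T => ?_
  obtain ⟨x, y, hs, hT⟩ := T.2
  simp only [← (hasSum_inner_tracePairing T hs hT _).tsum_eq]
  refine tendsto_tsum_of_dominated_convergence (bound := fun n => c * (‖x n‖ * ‖y n‖))
    (hs.mul_left c) (fun n => hlim _ _) (Filter.Eventually.of_forall fun i n => ?_)
  calc ‖⟪y n, B i (x n)⟫_ℂ‖ ≤ ‖y n‖ * ‖B i (x n)‖ := norm_inner_le_norm _ _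
    _ ≤ ‖y n‖ * (c * ‖x n‖) := by gcongr; exact (B i).le_of_opNorm_le (hB i) _
    _ = c * (‖x n‖ * ‖y n‖) := by ring

end UltraweakTopology

section Tensor

variable {H K : Type*} [NormedAddCommGroup H] [InnerProductSpace ℂ H]
  [NormedAddCommGroup K] [InnerProductSpace ℂ K]

theorem inner_htmul_polarization (C : HTensor H K →L[ℂ] HTensor H K) (x x' : H) (y y' : K) :
    ⟪htmul x' y', C (htmul x y)⟫_ℂ = 4⁻¹ * ∑ k ∈ Finset.range 4, (-Complex.I) ^ k *
      ⟪htmul (x' + Complex.I ^ k • x) y', C (htmul (x' + Complex.I ^ k • x) y)⟫_ℂ := by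
  simp only [Finset.sum_range_succ, Finset.sum_range_zero, pow_zero, pow_one, neg_sq,
    Complex.I_sq, Odd.neg_pow (by decide : Odd 3), Complex.I_pow_three, htmul_add_left,
    htmul_smul_left, map_add, map_smul, map_neg, map_one, inner_add_left, inner_add_right,
    inner_smul_left, inner_smul_right, Complex.conj_I]
  ring_nf
  simp only [Complex.I_sq]
  ring

theorem tendsto_inner_of_tendsto_inner_htmul {ι : Type*} {l : Filter ι}
    {B : ι → HTensor H K →L[ℂ] HTensor H K} {A : HTensor H K →L[ℂ] HTensor H K} {c : ℝ}
    (hB : ∀ i, ‖B i‖ ≤ c)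
    (hlim : ∀ x y x' y', Filter.Tendsto (fun i => ⟪htmul x' y', B i (htmul x y)⟫_ℂ) l
      (𝓝 ⟪htmul x' y', A (htmul x y)⟫_ℂ)) (z w : HTensor H K) :
    Filter.Tendsto (fun i => ⟪w, B i z⟫_ℂ) l (𝓝 ⟪w, A z⟫_ℂ) := by
  have hbound : ∀ i z w, ‖⟪w, B i z⟫_ℂ‖ ≤ ‖w‖ * (c * ‖z‖) := fun i z w =>
    (norm_inner_le_norm _ _).trans (by gcongr; exact (B i).le_of_opNorm_le (hB i) z)
  have hclosed_right : ∀ w, IsClosed {z | Filter.Tendsto (fun i => ⟪w, B i z⟫_ℂ) l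
      (𝓝 ⟪w, A z⟫_ℂ)} := fun w =>
    isClosed_setOf_tendsto_of_norm_le (f := fun i => innerSL ℂ w ∘L B i) (c := ‖w‖ * c)
      (fun i z => (hbound i z w).trans_eq (mul_assoc _ _ _).symm) (by fun_prop)
  have hclosed_left : ∀ z, IsClosed {w | Filter.Tendsto (fun i => ⟪w, B i z⟫_ℂ) l
      (𝓝 ⟪w, A z⟫_ℂ)} := fun z =>
    isClosed_setOf_tendsto_of_norm_le (f := fun i => innerSLFlip ℂ (B i z)) (c := c * ‖z‖)
      (fun i w => (hbound i z w).trans_eq (mul_comm _ _)) (by fun_prop)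
  refine htmul_induction z (hclosed_right w) (fun x y => ?_) fun z₁ z₂ h₁ h₂ => by
    simpa only [map_add, inner_add_right] using h₁.add h₂
  exact htmul_induction w (hclosed_left _) (fun x' y' => hlim x y x' y') fun w₁ w₂ h₁ h₂ => by
    simpa only [inner_add_left] using h₁.add h₂

theorem hasSum_rankOne_htmul {ι κ : Type*} {S : H →L[ℂ] H} {T : K →L[ℂ] K} {x y : ι → H}
    {u v : κ → K} (hxy : Summable fun i => ‖x i‖ * ‖y i‖)
    (hS : HasSum (fun i => rankOne ℂ (x i) (y i)) S) (huv : Summable fun j => ‖u j‖ * ‖v j‖)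
    (hT : HasSum (fun j => rankOne ℂ (u j) (v j)) T) :
    (Summable fun p : ι × κ => ‖htmul (x p.1) (u p.2)‖ * ‖htmul (y p.1) (v p.2)‖) ∧
      HasSum (fun p : ι × κ => rankOne ℂ (htmul (x p.1) (u p.2)) (htmul (y p.1) (v p.2)))
        (tensorOp S T) := by
  have hs : Summable fun p : ι × κ => ‖htmul (x p.1) (u p.2)‖ * ‖htmul (y p.1) (v p.2)‖ := by
    simpa only [norm_htmul, mul_mul_mul_comm] using
      hxy.mul_of_nonneg huv (fun _ => by positivity) fun _ => by positivity
  have hsum : Summable fun p : ι × κ =>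
      rankOne ℂ (htmul (x p.1) (u p.2)) (htmul (y p.1) (v p.2)) :=
    Summable.of_norm (by simpa only [norm_rankOne] using hs)
  refine ⟨hs, ?_⟩
  rw [(hasSum_tensorOp_left hS T).unique (hsum.hasSum.prod_fiberwise fun i => ?_)]
  · exact hsum.hasSum
  · simpa only [tensorOp_rankOne] using hasSum_tensorOp_right hT (rankOne ℂ (x i) (y i))

section TraceClass

variable [CompleteSpace H] [CompleteSpace K]

theorem opTrace_tensorOp {S : H →L[ℂ] H} {T : K →L[ℂ] K} (hS : IsTraceClass S)
    (hT : IsTraceClass T) : opTrace (tensorOp S T) = opTrace S * opTrace T := by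
  obtain ⟨x, y, hxy, hS⟩ := hS
  obtain ⟨u, v, huv, hT⟩ := hT
  obtain ⟨hs, hsum⟩ := hasSum_rankOne_htmul hxy hS huv hT
  have trS := hasSum_inner_opTrace hxy hS
  have trT := hasSum_inner_opTrace huv hT
  have trST := hasSum_inner_opTrace hs hsum
  simp only [inner_htmul] at trST
  rw [← trST.tsum_eq, ← trS.tsum_eq, ← trT.tsum_eq,
    tsum_mul_tsum_of_summable_norm trS.summable.norm trT.summable.norm]

theorem tracePairing_tensor_tensorOp (S : TraceClass H) (T : TraceClass K) (A : H →L[ℂ] H)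
    (B : K →L[ℂ] K) :
    tracePairing (HTensor H K) (TraceClass.tensor S T) (tensorOp A B) =
      tracePairing H S A * tracePairing K T B := by
  change opTrace (tensorOp S.1 T.1 * tensorOp A B) = opTrace (S.1 * A) * opTrace (T.1 * B)
  rw [← tensorOp_mul, opTrace_tensorOp (S.2.comp_right A) (T.2.comp_right B)]

theorem tracePairing_tensor_rankOne (x y : H) (u v : K) (B : HTensor H K →L[ℂ] HTensor H K) :
    tracePairing (HTensor H K) (TraceClass.tensor ⟨rankOne ℂ x y, isTraceClass_rankOne x y⟩
      ⟨rankOne ℂ u v, isTraceClass_rankOne u v⟩) B = ⟪htmul y v, B (htmul x u)⟫_ℂ := by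
  rw [← tracePairing_rankOne]
  congr 2
  exact Subtype.ext (tensorOp_rankOne x y u v)

end TraceClass

end Tensor

section RiemannSums

variable {G : Type*} [Group G] [TopologicalSpace G] [MeasurableSpace G]
variable {H H' K : Type*} [NormedAddCommGroup H] [InnerProductSpace ℂ H] [CompleteSpace H]
  [NormedAddCommGroup H'] [InnerProductSpace ℂ H'] [CompleteSpace H']
  [NormedAddCommGroup K] [InnerProductSpace ℂ K] [CompleteSpace K]

theorem Frame.sum_E_fibers (R : Frame G H) {β : Type*} (s : SimpleFunc G β) :
    ∑ v ∈ s.range, R.E (s ⁻¹' {v}) = 1 := by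
  rw [← ContinuousLinearMap.coe_inj, ← ext_inner_map]
  intro x
  have hmeasure : ∑ v ∈ s.range, (R.measure x).real (s ⁻¹' {v}) = (R.measure x).real Set.univ := by
    simpa using (integral_comp_simpleFunc (R.measure x) s fun _ => (1 : ℝ)).symm
  have hinner : ∑ v ∈ s.range, ⟪x, R.E (s ⁻¹' {v}) x⟫_ℂ = ⟪x, x⟫_ℂ := by
    have h := congrArg ((↑) : ℝ → ℂ) hmeasure
    simp only [Complex.ofReal_sum, R.measureReal_apply x (s.measurableSet_fiber _),
      R.measureReal_apply x MeasurableSet.univ, R.E_univ] at h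
    exact h
  rw [← inner_conj_symm, ← inner_conj_symm (x := (_ : H →ₗ[ℂ] H) x)]
  congr 1
  simpa [inner_sum] using hinner

/-- The Riemann sum `∑ᵥ E(s⁻¹{v}) ⊗ v.A` of `∫_G dE(g) ⊗ g.A` along a simple function `s`. -/
noncomputable def Frame.relativizationSum (R : Frame G H) (u : UnitaryRep G K) (s : SimpleFunc G G)
    (A : K →L[ℂ] K) : HTensor H K →L[ℂ] HTensor H K :=
  ∑ v ∈ s.range, tensorOp (R.E (s ⁻¹' {v})) (u.act v A)

theorem Frame.norm_relativizationSum_le (R : Frame G H) (u : UnitaryRep G K) (s : SimpleFunc G G)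
    (A : K →L[ℂ] K) : ‖R.relativizationSum u s A‖ ≤ ‖A‖ :=
  norm_sum_tensorOp_le _ _ _ (fun v _ => R.E_pos _ (s.measurableSet_fiber v)) (R.sum_E_fibers s) _
    (norm_nonneg _) fun v _ => u.norm_act_le v A

theorem Frame.inner_relativizationSum (R : Frame G H) (u : UnitaryRep G K) (s : SimpleFunc G G)
    (A : K →L[ℂ] K) (x : H) (y y' : K) :
    ⟪htmul x y', R.relativizationSum u s A (htmul x y)⟫_ℂ =
      ∫ g, ⟪y', u.act (s g) A y⟫_ℂ ∂(R.measure x) := by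
  rw [integral_comp_simpleFunc (R.measure x) s fun v => ⟪y', u.act v A y⟫_ℂ]
  simp only [relativizationSum, _root_.sum_apply, inner_sum, tensorOp_htmul, inner_htmul,
    Complex.real_smul, R.measureReal_apply x (s.measurableSet_fiber _)]

theorem Frame.tracePairing_relativizationSum (R : Frame G H) (u : UnitaryRep G K)
    (s : SimpleFunc G G) (A : K →L[ℂ] K) (ω : TraceClass H) (ρ : TraceClass K) :
    tracePairing (HTensor H K) (TraceClass.tensor ω ρ) (R.relativizationSum u s A) =
      ∑ v ∈ s.range, tracePairing H ω (R.E (s ⁻¹' {v})) * tracePairing K ρ (u.act v A) := by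
  simp only [relativizationSum, map_sum, tracePairing_tensor_tensorOp]

variable [BorelSpace G] [IsTopologicalGroup G] [SecondCountableTopology G] [T2Space G]

theorem Frame.tendsto_inner_relativizationSum (R : Frame G H) (u : UnitaryRep G K)
    {s : ℕ → SimpleFunc G G} (hs : ∀ g, Filter.Tendsto (fun n => s n g) Filter.atTop (𝓝 g))
    (A : K →L[ℂ] K) (x x' : H) (y y' : K) :
    Filter.Tendsto (fun n => ⟪htmul x' y', R.relativizationSum u (s n) A (htmul x y)⟫_ℂ)
      Filter.atTop (𝓝 ⟪htmul x' y', R.relativization u A (htmul x y)⟫_ℂ) := by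
  have hdiag : ∀ x : H,
      Filter.Tendsto (fun n => ⟪htmul x y', R.relativizationSum u (s n) A (htmul x y)⟫_ℂ)
        Filter.atTop (𝓝 ⟪htmul x y', R.relativization u A (htmul x y)⟫_ℂ) := by
    intro x
    simp only [R.inner_relativizationSum, R.isRelativization_relativization u A x y y']
    have hcont := u.continuous_inner_act A y y'
    refine tendsto_integral_of_dominated_convergence (fun _ => ‖y'‖ * (‖A‖ * ‖y‖))
      (fun n => (hcont.comp_stronglyMeasurable (s n).stronglyMeasurable).aestronglyMeasurable)
      (integrable_const _) (fun n => Filter.Eventually.of_forall fun g => ?_)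
      (Filter.Eventually.of_forall fun g => (hcont.tendsto g).comp (hs g))
    refine (norm_inner_le_norm _ _).trans ?_
    gcongr
    exact ContinuousLinearMap.le_of_opNorm_le _ (u.norm_act_le _ _) _
  simp only [inner_htmul_polarization _ x x']
  exact (tendsto_finsetSum _ fun k _ => (hdiag _).const_mul _).const_mul _

theorem Frame.tendsto_relativizationSum (R : Frame G H) (u : UnitaryRep G K)
    {s : ℕ → SimpleFunc G G} (hs : ∀ g, Filter.Tendsto (fun n => s n g) Filter.atTop (𝓝 g))
    (A : K →L[ℂ] K) :
    Filter.Tendsto (fun n => R.relativizationSum u (s n) A) Filter.atTop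
      (@nhds _ (ultraweak (HTensor H K)) (R.relativization u A)) :=
  have hbound := fun n => R.norm_relativizationSum_le u (s n) A
  tendsto_ultraweak_of_bounded hbound <| tendsto_inner_of_tendsto_inner_htmul hbound
    fun x y x' y' => R.tendsto_inner_relativizationSum u hs A x x' y y'

theorem tracePairing_relativization_congr {R : Frame G H} {R' : Frame G H'} {ω : TraceClass H}
    {ω' : TraceClass H'}
    (h : ∀ X, MeasurableSet X → tracePairing H' ω' (R'.E X) = tracePairing H ω (R.E X))
    (u : UnitaryRep G K) (A : K →L[ℂ] K) (ρ : TraceClass K) :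
    tracePairing (HTensor H' K) (TraceClass.tensor ω' ρ) (R'.relativization u A) =
      tracePairing (HTensor H K) (TraceClass.tensor ω ρ) (R.relativization u A) := by
  have hs := (stronglyMeasurable_id (α := G)).tendsto_approx
  have hlim := tendsto_ultraweak_iff.1 (R.tendsto_relativizationSum u hs A)
    (TraceClass.tensor ω ρ)
  have hlim' := tendsto_ultraweak_iff.1 (R'.tendsto_relativizationSum u hs A)
    (TraceClass.tensor ω' ρ)
  refine tendsto_nhds_unique hlim' (hlim.congr fun n => ?_)
  simp only [Frame.tracePairing_relativizationSum, h _ (SimpleFunc.measurableSet_fiber _ _)]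

end RiemannSums

section Predual

variable {H H' : Type*} [NormedAddCommGroup H] [InnerProductSpace ℂ H] [CompleteSpace H]
  [NormedAddCommGroup H'] [InnerProductSpace ℂ H'] [CompleteSpace H']

theorem exists_apply_eq_of_mem_graph {𝕜 E F : Type*} [Ring 𝕜] [AddCommGroup E] [Module 𝕜 E]
    [AddCommGroup F] [Module 𝕜 F] {f : E →ₗ.[𝕜] F} {x : E} {y : F} (h : (x, y) ∈ f.graph) :
    ∃ hx : x ∈ f.domain, f ⟨x, hx⟩ = y :=
  have hx := LinearPMap.mem_domain_of_mem_graph h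
  ⟨hx, ((LinearPMap.image_iff hx).2 h).symm⟩

theorem Predual.mk_surjective (V : Submodule ℂ (H →L[ℂ] H)) : Function.Surjective (Predual.mk V) :=
  Submodule.mkQ_surjective _

theorem Predual.ext_pairing {V : Submodule ℂ (H →L[ℂ] H)} {s t : Predual V}
    (h : ∀ A : V, Predual.pairing V s A = Predual.pairing V t A) : s = t :=
  Predual.pairing_injective V (LinearMap.ext h)

theorem Predual.ext_of_ultraweakClosure {W : Submodule ℂ (H →L[ℂ] H)}
    {s t : Predual (ultraweakClosure W)}
    (h : ∀ (A : H →L[ℂ] H) (hA : A ∈ W), Predual.pairing _ s ⟨A, le_ultraweakClosure W hA⟩ =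
      Predual.pairing _ t ⟨A, le_ultraweakClosure W hA⟩) : s = t := by
  obtain ⟨S, rfl⟩ := Predual.mk_surjective _ s
  obtain ⟨T, rfl⟩ := Predual.mk_surjective _ t
  have hclosed : IsClosed[ultraweak H] {A | tracePairing H S A = tracePairing H T A} :=
    @isClosed_eq _ _ _ (ultraweak H) _ _ _ (continuous_tracePairing S) (continuous_tracePairing T)
  exact Predual.ext_pairing fun A =>
    @closure_minimal _ (ultraweak H) (W : Set (H →L[ℂ] H)) _ (fun A hA => h A hA) hclosed A.1 A.2

theorem mem_graph_partialPredual_iff {V : Submodule ℂ (H →L[ℂ] H)}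
    {V' : Submodule ℂ (H' →L[ℂ] H')} {f : V →ₗ.[ℂ] V'}
    (hf : ∀ t : Predual V, (∀ A : f.domain, Predual.pairing V t A = 0) → t = 0)
    {t' : Predual V'} {t : Predual V} :
    (t', t) ∈ (partialPredual f).graph ↔
      ∀ A : f.domain, Predual.pairing V t A = Predual.pairing V' t' (f A) := by
  rw [partialPredual, Submodule.toLinearPMap_graph_eq]
  · rfl
  · rintro ⟨s', s⟩ hs rfl
    exact hf s fun A => (hs A).trans (by rw [map_zero, LinearMap.zero_apply])

variable {G : Type*} [Group G] [TopologicalSpace G]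
  {S : SemiQuantumSystem G H} {S' : SemiQuantumSystem G H'}

theorem Channel.mk_eq_predual_mk_iff {φ : Channel S S'} {ω : TraceClass H} {ω' : TraceClass H'} :
    Predual.mk S.V ω = φ.predual (Predual.mk S'.V ω') ↔
      ∀ A : S.V, tracePairing H ω A = tracePairing H' ω' (φ.toLin A) := by
  simp only [← Predual.pairing_mk S.V, ← Predual.pairing_mk S'.V, ← pairing_predualMap _ φ.normal]
  exact ⟨fun h A => by rw [h]; rfl, Predual.ext_pairing⟩

end Predual

section ExternalTransformation

variable {G : Type*} [Group G] [TopologicalSpace G] [IsTopologicalGroup G]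
  [SecondCountableTopology G] [T2Space G] [MeasurableSpace G] [BorelSpace G]
variable {H H' K : Type*} [NormedAddCommGroup H] [InnerProductSpace ℂ H] [CompleteSpace H]
  [NormedAddCommGroup H'] [InnerProductSpace ℂ H'] [CompleteSpace H']
  [NormedAddCommGroup K] [InnerProductSpace ℂ K] [CompleteSpace K]
variable {R : Frame G H} {R' : Frame G H'}

theorem FrameMorphism.tracePairing_relativization (ψ : FrameMorphism R R') {ω : TraceClass H}
    {ω' : TraceClass H'} (h : Predual.mk R.V ω = ψ.toChannel.predual (Predual.mk R'.V ω'))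
    (u : UnitaryRep G K) (A : K →L[ℂ] K) (ρ : TraceClass K) :
    tracePairing (HTensor H' K) (TraceClass.tensor ω' ρ) (R'.relativization u A) =
      tracePairing (HTensor H K) (TraceClass.tensor ω ρ) (R.relativization u A) := by
  refine tracePairing_relativization_congr (fun X hX => ?_) u A ρ
  rw [ψ.map_E X hX, ← Channel.mk_eq_predual_mk_iff.1 h]

theorem FrameMorphism.relativization_eq_zero (ψ : FrameMorphism R R') (u : UnitaryRep G K)
    {A : K →L[ℂ] K} (hA : R.relativization u A = 0) : R'.relativization u A = 0 := by
  refine op_ext_inner fun x y x' y' => ?_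
  obtain ⟨ω, hω⟩ := Predual.mk_surjective R.V
    (ψ.toChannel.predual (Predual.mk R'.V ⟨rankOne ℂ x x', isTraceClass_rankOne x x'⟩))
  rw [← tracePairing_tensor_rankOne, ψ.tracePairing_relativization hω, hA, map_zero,
    _root_.zero_apply, inner_zero_right]

theorem mem_graph_yenMap_iff (ψ : FrameMorphism R R') (S : SemiQuantumSystem G K)
    {p : relOps R S × relOps R' S} :
    p ∈ (yenMap ψ (Channel.id S)).graph ↔ ∃ A : S.V, (relMap R S A, relMap R' S A) = p := by
  rw [yenMap, Submodule.toLinearPMap_graph_eq]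
  · rfl
  · rintro _ ⟨A, rfl⟩ hA
    exact Subtype.ext (ψ.relativization_eq_zero S.rep (congrArg Subtype.val hA))

theorem yenMap_relMap (ψ : FrameMorphism R R') (S : SemiQuantumSystem G K) (A : S.V) :
    ∃ hA : relMap R S A ∈ (yenMap ψ (Channel.id S)).domain,
      yenMap ψ (Channel.id S) ⟨relMap R S A, hA⟩ = relMap R' S A :=
  exists_apply_eq_of_mem_graph ((mem_graph_yenMap_iff ψ S).2 ⟨A, rfl⟩)

theorem Predual.ext_relMap {S : SemiQuantumSystem G K} {s t : Predual (relOps R S)}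
    (h : ∀ A : S.V, Predual.pairing _ s (relMap R S A) = Predual.pairing _ t (relMap R S A)) :
    s = t :=
  Predual.ext_of_ultraweakClosure <| by
    rintro _ ⟨A, hA, rfl⟩
    exact h ⟨A, hA⟩

theorem mem_graph_externalTransformation_iff (ψ : FrameMorphism R R') (S : SemiQuantumSystem G K)
    {t' : Predual (relOps R' S)} {t : Predual (relOps R S)} :
    (t', t) ∈ (externalTransformation ψ S).graph ↔
      ∀ A : S.V, Predual.pairing _ t (relMap R S A) = Predual.pairing _ t' (relMap R' S A) := by
  have hdet : ∀ s : Predual (relOps R S),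
      (∀ B : (yenMap ψ (Channel.id S)).domain, Predual.pairing _ s B = 0) → s = 0 := fun s hs =>
    Predual.ext_relMap fun A => by
      rw [hs ⟨_, (yenMap_relMap ψ S A).1⟩, map_zero, LinearMap.zero_apply]
  refine (mem_graph_partialPredual_iff hdet).trans ⟨fun h A => ?_, fun h B => ?_⟩
  · obtain ⟨hA, hYA⟩ := yenMap_relMap ψ S A
    exact (h ⟨_, hA⟩).trans (congrArg _ hYA)
  · obtain ⟨A, hA⟩ := (mem_graph_yenMap_iff ψ S).1 ((yenMap ψ (Channel.id S)).mem_graph B)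
    obtain ⟨hB, hYB⟩ := Prod.mk.inj hA
    rw [← hB, ← hYB, h A]

theorem externalTransformation_productRelative (ψ : FrameMorphism R R') (S : SemiQuantumSystem G K)
    {ω : TraceClass H} {ω' : TraceClass H'}
    (h : Predual.mk R.V ω = ψ.toChannel.predual (Predual.mk R'.V ω')) (ρ : TraceClass K) :
    ∃ hd : productRelative R' S ω' ρ ∈ (externalTransformation ψ S).domain,
      externalTransformation ψ S ⟨productRelative R' S ω' ρ, hd⟩ = productRelative R S ω ρ :=
  exists_apply_eq_of_mem_graph <| (mem_graph_externalTransformation_iff ψ S).2 fun A =>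
    (ψ.tracePairing_relativization h S.rep A ρ).symm

theorem predualMap_productRelative (ψ : FrameMorphism R R') (S : SemiQuantumSystem G K)
    {ω : TraceClass H} {ω' : TraceClass H'}
    (h : Predual.mk R.V ω = ψ.toChannel.predual (Predual.mk R'.V ω')) (ρ : TraceClass K)
    (Y : relOps R S →ₗ[ℂ] relOps R' S) (hY : IsNormalMap Y)
    (hYA : ∀ A : S.V, Y (relMap R S A) = relMap R' S A) :
    predualMap Y hY (productRelative R' S ω' ρ) = productRelative R S ω ρ := by
  refine Predual.ext_relMap fun A => ?_
  rw [pairing_predualMap, hYA]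
  exact ψ.tracePairing_relativization h S.rep A ρ

end ExternalTransformation

section States

variable {H H' : Type*} [NormedAddCommGroup H] [InnerProductSpace ℂ H] [CompleteSpace H]
  [NormedAddCommGroup H'] [InnerProductSpace ℂ H'] [CompleteSpace H']

open ComplexOrder in
theorem tracePairing_nonneg {ω : TraceClass H} (hω : (ω : H →L[ℂ] H).IsPositive)
    {A : H →L[ℂ] H} (hA : A.IsPositive) : 0 ≤ tracePairing H ω A := by
  set r : H →L[ℂ] H := CFC.sqrt A
  have hr : r * r = A :=
    CFC.sqrt_mul_sqrt_self A ((ContinuousLinearMap.nonneg_iff_isPositive _).2 hA)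
  have hra : r.adjoint = r :=
    ContinuousLinearMap.isSelfAdjoint_iff'.1 (IsSelfAdjoint.of_nonneg (CFC.sqrt_nonneg A))
  have hcycle : tracePairing H ω A = opTrace (r * (ω.1 * r)) := by
    rw [opTrace_mul_comm (IsTraceClass.comp_right ω.2 r), mul_assoc, hr]
    rfl
  rw [hcycle]
  refine tsum_nonneg fun i => ?_
  rw [_root_.mul_apply_eq_comp, _root_.mul_apply_eq_comp, ← ContinuousLinearMap.adjoint_inner_left,
    hra]
  exact hω.inner_nonneg_right _

theorem tracePairing_rankOne_right (ω : TraceClass H) (x y : H) :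
    tracePairing H ω (rankOne ℂ x y) = ⟪y, (ω : H →L[ℂ] H) x⟫_ℂ := by
  change opTrace (ω.1 * rankOne ℂ x y) = _
  rw [ContinuousLinearMap.mul_def, comp_rankOne, opTrace_rankOne]

open ComplexOrder in
theorem isState_iff_tracePairing (ω : TraceClass H) :
    IsState ω ↔ (∀ A : H →L[ℂ] H, A.IsPositive → 0 ≤ tracePairing H ω A) ∧
      tracePairing H ω 1 = 1 := by
  rw [IsState, tracePairing_one]
  refine and_congr_left fun _ => ⟨fun h A hA => tracePairing_nonneg h hA, fun h => ?_⟩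
  have hnonneg : ∀ x, 0 ≤ ⟪x, (ω : H →L[ℂ] H) x⟫_ℂ := fun x =>
    tracePairing_rankOne_right ω x x ▸ h _ (isPositive_rankOne_self x)
  rw [ContinuousLinearMap.isPositive_iff_complex]
  intro x
  obtain ⟨hre, him⟩ := Complex.nonneg_iff.1 (hnonneg x)
  rw [← inner_conj_symm, Complex.conj_eq_iff_im.2 him.symm]
  exact ⟨Complex.ext rfl him, hre⟩

variable {G : Type*} [Group G] [TopologicalSpace G]

theorem isState_of_mk_eq_predual {S : SemiQuantumSystem G H} {S' : SemiQuantumSystem G H'}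
    {φ : Channel S S'} {ω : TraceClass H} {ω' : TraceClass H'} (hω' : IsState ω') (hS : S.V = ⊤)
    (h : Predual.mk S.V ω = φ.predual (Predual.mk S'.V ω')) : IsState ω := by
  rw [isState_iff_tracePairing] at hω' ⊢
  rw [Channel.mk_eq_predual_mk_iff] at h
  refine ⟨fun A hA => ?_, ?_⟩
  · have hm : A ∈ S.V := hS ▸ Submodule.mem_top
    rw [h ⟨A, hm⟩]
    exact hω'.1 _ (φ.positive ⟨A, hm⟩ hA)
  · rw [h ⟨1, S.one_mem⟩, φ.unital, hω'.2]

theorem isState_predualAct (u : UnitaryRep G H) (h : G) {ω : TraceClass H} (hω : IsState ω) :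
    IsState (u.predualAct h ω) := by
  rw [isState_iff_tracePairing] at hω ⊢
  simp only [u.tracePairing_predualAct, u.act_id]
  exact ⟨fun A hA => hω.1 _ (u.act_isPositive h hA), hω.2⟩

theorem mk_predualAct (u : UnitaryRep G H) (h : G) {S S' : SemiQuantumSystem G H} {φ : Channel S S'}
    (hφ : ∀ A : S.V, (φ.toLin A : H →L[ℂ] H) = u.act h A) (ω : TraceClass H) :
    Predual.mk S.V (u.predualAct h ω) = φ.predual (Predual.mk S'.V ω) :=
  Channel.mk_eq_predual_mk_iff.2 fun A => by rw [hφ, u.tracePairing_predualAct]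

end States

end QRF

theorem mainTheorem3_general {G : Type*} [Group G] [TopologicalSpace G] [IsTopologicalGroup G]
    [SecondCountableTopology G] [T2Space G] [MeasurableSpace G] [BorelSpace G]
    {HR HR' HS : Type*}
    [NormedAddCommGroup HR] [InnerProductSpace ℂ HR] [CompleteSpace HR]
    [NormedAddCommGroup HR'] [InnerProductSpace ℂ HR'] [CompleteSpace HR']
    [NormedAddCommGroup HS] [InnerProductSpace ℂ HS] [CompleteSpace HS]
    (R : QRF.Frame G HR) (R' : QRF.Frame G HR') (ψ : QRF.FrameMorphism R R')
    (S : QRF.SemiQuantumSystem G HS) :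
    (∀ A : S.V, ∃ hA : QRF.relMap R S A ∈ (QRF.yenMap ψ (QRF.Channel.id S)).domain,
      QRF.yenMap ψ (QRF.Channel.id S) ⟨QRF.relMap R S A, hA⟩ = QRF.relMap R' S A) ∧
    (∀ (ω' : QRF.TraceClass HR') (ρ : QRF.TraceClass HS) (ω : QRF.TraceClass HR),
      QRF.Predual.mk R.V ω = ψ.toChannel.predual (QRF.Predual.mk R'.V ω') →
      (QRF.IsState ω' → R.V = ⊤ → QRF.IsState ω) ∧
      (∃ h : QRF.productRelative R' S ω' ρ ∈ (QRF.externalTransformation ψ S).domain,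
        QRF.externalTransformation ψ S ⟨QRF.productRelative R' S ω' ρ, h⟩ =
          QRF.productRelative R S ω ρ) ∧
      (∀ (Y : QRF.relOps R S →ₗ[ℂ] QRF.relOps R' S) (hY : QRF.IsNormalMap Y),
        (∀ A : S.V, Y (QRF.relMap R S A) = QRF.relMap R' S A) →
        QRF.predualMap Y hY (QRF.productRelative R' S ω' ρ) = QRF.productRelative R S ω ρ) ∧
      (∀ A : S.V,
        QRF.tracePairing (QRF.HTensor HR' HS) (QRF.TraceClass.tensor ω' ρ)
            (R'.relativization S.rep A) =
          QRF.tracePairing (QRF.HTensor HR HS) (QRF.TraceClass.tensor ω ρ)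
            (R.relativization S.rep A))) ∧
    (∀ (h : G) (ω : QRF.TraceClass HR) (ρ : QRF.TraceClass HS),
      (QRF.IsState ω → QRF.IsState (R.rep.predualAct h ω)) ∧
      (∃ hd : QRF.productRelative (R.reorient h) S ω ρ ∈
          (QRF.externalTransformation (R.reorientMorphism h) S).domain,
        QRF.externalTransformation (R.reorientMorphism h) S
            ⟨QRF.productRelative (R.reorient h) S ω ρ, hd⟩ =
          QRF.productRelative R S (R.rep.predualAct h ω) ρ) ∧
      (∀ χ : QRF.FrameMorphism R R,
        (∀ A : R.V, (χ.toLin A : HR →L[ℂ] HR) = R.rep.act h A) →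
        ∃ hd : QRF.productRelative R S ω ρ ∈ (QRF.externalTransformation χ S).domain,
          QRF.externalTransformation χ S ⟨QRF.productRelative R S ω ρ, hd⟩ =
            QRF.productRelative R S (R.rep.predualAct h ω) ρ)) := by
  refine ⟨QRF.yenMap_relMap ψ S, fun ω' ρ ω hω => ⟨?_, ?_, ?_, ?_⟩,
    fun h ω ρ => ⟨QRF.isState_predualAct R.rep h, ?_, fun χ hχ => ?_⟩⟩
  · exact fun hω' hR => QRF.isState_of_mk_eq_predual hω' hR hω
  · exact QRF.externalTransformation_productRelative ψ S hω ρ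
  · exact QRF.predualMap_productRelative ψ S hω ρ
  · exact fun A => ψ.tracePairing_relativization hω S.rep A ρ
  · exact QRF.externalTransformation_productRelative (R.reorientMorphism h) S
      (QRF.mk_predualAct R.rep h (fun _ => rfl) ω) ρ
  · exact QRF.externalTransformation_productRelative χ S (QRF.mk_predualAct R.rep h hχ ω) ρ

theorem mainTheorem3 {G : Type*} [Group G] [TopologicalSpace G] [IsTopologicalGroup G]
    [LocallyCompactSpace G] [SecondCountableTopology G] [T2Space G] [MeasurableSpace G]
    [BorelSpace G] {HR HR' HS : Type*}
    [NormedAddCommGroup HR] [InnerProductSpace ℂ HR] [CompleteSpace HR]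
    [TopologicalSpace.SeparableSpace HR]
    [NormedAddCommGroup HR'] [InnerProductSpace ℂ HR'] [CompleteSpace HR']
    [TopologicalSpace.SeparableSpace HR']
    [NormedAddCommGroup HS] [InnerProductSpace ℂ HS] [CompleteSpace HS]
    [TopologicalSpace.SeparableSpace HS]
    (R : QRF.Frame G HR) (R' : QRF.Frame G HR') (ψ : QRF.FrameMorphism R R')
    (S : QRF.SemiQuantumSystem G HS) :
    -- `Y(ψ, id_S)` is well defined and maps `Y^R(A)` to `Y^R'(A)`
    (∀ A : S.V, ∃ hA : QRF.relMap R S A ∈ (QRF.yenMap ψ (QRF.Channel.id S)).domain,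
      QRF.yenMap ψ (QRF.Channel.id S) ⟨QRF.relMap R S A, hA⟩ = QRF.relMap R' S A) ∧
    -- its predual maps `ρ^(ω')` to `ρ^(ω)`, for every representative `ω` of `ψ_*(ω')`
    (∀ (ω' : QRF.TraceClass HR') (ρ : QRF.TraceClass HS), QRF.IsState ω' → QRF.IsState ρ →
      ∀ ω : QRF.TraceClass HR,
        QRF.Predual.mk R.V ω = ψ.toChannel.predual (QRF.Predual.mk R'.V ω') →
        (R.V = ⊤ → QRF.IsState ω) ∧
        (∃ h : QRF.productRelative R' S ω' ρ ∈ (QRF.externalTransformation ψ S).domain,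
          QRF.externalTransformation ψ S ⟨QRF.productRelative R' S ω' ρ, h⟩ =
            QRF.productRelative R S ω ρ) ∧
        -- the same for the everywhere defined predual of any normal extension of `Y(ψ, id_S)`
        (∀ (Y : QRF.relOps R S →ₗ[ℂ] QRF.relOps R' S) (hY : QRF.IsNormalMap Y),
          (∀ A : S.V, Y (QRF.relMap R S A) = QRF.relMap R' S A) →
          QRF.predualMap Y hY (QRF.productRelative R' S ω' ρ) = QRF.productRelative R S ω ρ) ∧
        -- the two product-relative states agree as states of the system, `Y^R'_*(ω' ⊗ ρ) = Y^R_*(ω ⊗ ρ)`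
        (∀ A : S.V,
          QRF.tracePairing (QRF.HTensor HR' HS) (QRF.TraceClass.tensor ω' ρ) (R'.relativization S.rep A) =
            QRF.tracePairing (QRF.HTensor HR HS) (QRF.TraceClass.tensor ω ρ) (R.relativization S.rep A))) ∧
    -- frame reorientations `h._ : R → h.R`, and `h._ : R → R` when this is a frame morphism
    (∀ (h : G) (ω : QRF.TraceClass HR) (ρ : QRF.TraceClass HS), QRF.IsState ω → QRF.IsState ρ →
      QRF.IsState (R.rep.predualAct h ω) ∧
      (∃ hd : QRF.productRelative (R.reorient h) S ω ρ ∈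
          (QRF.externalTransformation (R.reorientMorphism h) S).domain,
        QRF.externalTransformation (R.reorientMorphism h) S
            ⟨QRF.productRelative (R.reorient h) S ω ρ, hd⟩ =
          QRF.productRelative R S (R.rep.predualAct h ω) ρ) ∧
      (∀ χ : QRF.FrameMorphism R R,
        (∀ A : R.V, (χ.toLin A : HR →L[ℂ] HR) = R.rep.act h A) →
        ∃ hd : QRF.productRelative R S ω ρ ∈ (QRF.externalTransformation χ S).domain,
          QRF.externalTransformation χ S ⟨QRF.productRelative R S ω ρ, hd⟩ =
            QRF.productRelative R S (R.rep.predualAct h ω) ρ)) := by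
  obtain ⟨hY, hproduct, hreorient⟩ := mainTheorem3_general R R' ψ S
  exact ⟨hY, fun ω' ρ hω' _ ω hω => (hproduct ω' ρ ω hω).imp_left (· hω'),
    fun h ω ρ hω _ => (hreorient h ω ρ).imp_left (· hω)⟩
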